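/- Let $p$ be a prime and let $\Omega$ be an algebraically closed field with an absolute value extending the $p$-adic absolute value of $\mathbb{Q}_p$ (for instance $\overline{\mathbb{Q}}_p$ or its completion). For a subfield $k \subseteq \Omega$ containing $\mathbb{Q}_p$ put $O_k = \{x \in k : |x| \le 1\}$. Let $K \subseteq E \subseteq \Omega$ be finite extensions of $\mathbb{Q}_p$ with $E/K$ unramified, let $\pi$ be a generator of the maximal ideal of $O_K$, and let $A_\pi$ be the ring of integers of $\mathbb{Q}_p(\pi)$. Let $\mathfrak{F}$ be a formal $A_\pi$-module over $O_E$: a one-dimensional commutative formal group law $\mathfrak{F}(X,Y) \in O_E[[X,Y]]$ with a ring homomorphism $a \mapsto [a]$ from $A_\pi$ to the ring of endomorphisms of $\mathfrak{F}$ over $O_E$ such that $[a](X) \equiv aX \pmod{X^2}$. Assume that $\mathfrak{F}$ has finite height, i.e. writing $[\pi](X) = \pi X + a_2X^2 + a_3X^3 + \cdots$, some $a_i$ with $i \ge 2$ is a unit of $O_E$. For a field $k$ with $E \subseteq k \subseteq \Omega$ let $\mathrm{End}_{O_k}(\mathfrak{F})$ be the ring of power series $f \in O_k[[X]]$ with $f(0)=0$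 and $f(\mathfrak{F}(X,Y)) = \mathfrak{F}(f(X),f(Y))$, with addition $\mathfrak{F}(f(X),g(X))$ and with composition as multiplication. Let $$\mathrm{End}(\mathfrak{F}) = \bigcup_k \mathrm{End}_{O_k}(\mathfrak{F})$$ be the absolute endomorphism ring, where $k$ runs over all fields $E \subseteq k \subseteq \Omega$ that are complete discrete valuation fields for the absolute value of $\Omega$. Then the union $\mathrm{End}(\mathfrak{F})$ is a ring (under these operations), a commutative integral domain, and it is integrally closed in its fraction field. -/

import Mathlib

namespace FormalGroup

open MvPowerSeries in
theorem hasSubst_pair {R τ : Type*} [CommRing R] {u v : MvPowerSeries τ R}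
    (hu : PowerSeries.HasSubst u) (hv : PowerSeries.HasSubst v) : HasSubst ![u, v] :=
  hasSubst_of_constantCoeff_nilpotent fun s => by fin_cases s <;> simpa

theorem hasSubst_add {R τ : Type*} [CommRing R] (F : FormalGroup R) {u v : MvPowerSeries τ R}
    (hu : PowerSeries.HasSubst u) (hv : PowerSeries.HasSubst v) :
    PowerSeries.HasSubst (MvPowerSeries.subst ![u, v] F.toPowerSeries) :=
  (show F.Point τ from (show F.Point τ from ⟨u, hu⟩) + (show F.Point τ from ⟨v, hv⟩)).2

theorem hasSubst_subst {R τ : Type*} [CommRing R] {f : PowerSeries R}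
    (hf : PowerSeries.constantCoeff f = 0) {u : MvPowerSeries τ R}
    (hu : PowerSeries.HasSubst u) : PowerSeries.HasSubst (PowerSeries.subst u f) :=
  MvPowerSeries.IsNilpotent_subst hu.const (f := f) (by
    rw [show MvPowerSeries.constantCoeff f = 0 from hf]; exact IsNilpotent.zero)

theorem subst_add_point {R τ υ : Type*} [CommRing R] (F : FormalGroup R)
    {u v : MvPowerSeries τ R} (hu : PowerSeries.HasSubst u) (hv : PowerSeries.HasSubst v)
    {b : τ → MvPowerSeries υ R} (hb : MvPowerSeries.HasSubst b) :
    MvPowerSeries.subst b (MvPowerSeries.subst ![u, v] F.toPowerSeries) =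
      MvPowerSeries.subst ![MvPowerSeries.subst b u, MvPowerSeries.subst b v] F.toPowerSeries := by
  rw [MvPowerSeries.subst_comp_subst_apply (hasSubst_pair hu hv) hb]
  congr 1
  funext s
  fin_cases s <;> rfl

theorem exists_inverse {R : Type*} [CommRing R] (F : FormalGroup R) :
    ∃ i : PowerSeries R, PowerSeries.constantCoeff i = 0 ∧
      MvPowerSeries.subst ![(PowerSeries.X : PowerSeries R), i] F.toPowerSeries = 0 := by
  classical
  set A : PowerSeries R → PowerSeries R := fun b =>
    MvPowerSeries.subst ![(PowerSeries.X : PowerSeries R), b] F.toPowerSeries with hA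
  set T : PowerSeries R → PowerSeries R := fun b => b - A b with hT
  have hsub : ∀ b : PowerSeries R, PowerSeries.constantCoeff b = 0 →
      MvPowerSeries.HasSubst ![(PowerSeries.X : PowerSeries R), b] := fun b hb =>
    hasSubst_pair PowerSeries.HasSubst.X' (PowerSeries.HasSubst.of_constantCoeff_zero' hb)
  have hA0 : ∀ b, PowerSeries.constantCoeff b = 0 → PowerSeries.constantCoeff (A b) = 0 := by
    intro b hb
    refine MvPowerSeries.constantCoeff_subst_eq_zero (hsub b hb) (fun s => ?_) F.zero_constantCoeff
    fin_cases s
    · exact PowerSeries.constantCoeff_X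
    · exact hb
  have hT0 : ∀ b, PowerSeries.constantCoeff b = 0 → PowerSeries.constantCoeff (T b) = 0 := by
    intro b hb
    simp [hT, hb, hA0 b hb]
  have key : ∀ (n : ℕ) (b c : PowerSeries R), PowerSeries.constantCoeff b = 0 →
      PowerSeries.constantCoeff c = 0 → (PowerSeries.X : PowerSeries R) ^ n ∣ b - c →
      (PowerSeries.X : PowerSeries R) ^ (n + 1) ∣ T b - T c := by
    intro n b c hb hc hbc
    rw [PowerSeries.X_pow_dvd_iff]
    intro m hm
    have e1 : T b - T c = (b - c) - (A b - A c) := by simp only [hT]; ring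
    rw [e1, map_sub, sub_eq_zero, map_sub (PowerSeries.coeff m) (A b)]
    have h1 := MvPowerSeries.coeff_subst (hsub b hb) F.toPowerSeries (Finsupp.single () m)
    have h2 := MvPowerSeries.coeff_subst (hsub c hc) F.toPowerSeries (Finsupp.single () m)
    have f1 := MvPowerSeries.coeff_subst_finite (hsub b hb) F.toPowerSeries (Finsupp.single () m)
    have f2 := MvPowerSeries.coeff_subst_finite (hsub c hc) F.toPowerSeries (Finsupp.single () m)
    change PowerSeries.coeff m (b - c) = MvPowerSeries.coeff (Finsupp.single () m) (A b) -
      MvPowerSeries.coeff (Finsupp.single () m) (A c)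
    simp only [hA]
    rw [h1, h2, ← finsum_sub_distrib f1 f2, finsum_eq_single _ (Finsupp.single 1 1)]
    · rw [map_sub]
      simp [F.lin_coeff_Y, PowerSeries.coeff]
    · intro d hd
      rw [← smul_sub, ← map_sub]
      have hdvd : (PowerSeries.X : PowerSeries R) ^ (n + 1) ∣
          (PowerSeries.X : PowerSeries R) ^ (d 0) * (b ^ (d 1) - c ^ (d 1)) := by
        have hbc' : b - c ∣ b ^ (d 1) - c ^ (d 1) := sub_dvd_pow_sub_pow _ _ _
        rcases Nat.eq_zero_or_pos (d 0) with h0 | h0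
        · rcases Nat.lt_or_ge (d 1) 2 with h3 | h3
          · have : d 1 = 0 := by
              by_contra hne
              apply hd
              ext s
              fin_cases s
              · simp [h0]
              · simp; omega
            simp [this]
          · rw [h0, pow_zero, one_mul, ← geom_sum₂_mul, pow_succ, mul_comm]
            refine mul_dvd_mul (Finset.dvd_sum fun i hi => ?_) hbc
            have hi' := Finset.mem_range.mp hi
            rcases Nat.eq_zero_or_pos i with h4 | h4
            · exact Dvd.dvd.mul_left (dvd_pow (PowerSeries.X_dvd_iff.mpr hc) (by omega)) _
            · exact Dvd.dvd.mul_right (dvd_pow (PowerSeries.X_dvd_iff.mpr hb) h4.ne') _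
        · rw [pow_succ, mul_comm (PowerSeries.X ^ n)]
          exact mul_dvd_mul (dvd_pow_self _ h0.ne') (hbc.trans hbc')
      have := (PowerSeries.X_pow_dvd_iff.mp hdvd) m hm
      simp only [Finsupp.prod_fintype, pow_zero, implies_true, Fin.prod_univ_two,
        Matrix.cons_val_zero, Matrix.cons_val_one]
      rw [← mul_sub]
      rw [show (MvPowerSeries.coeff (Finsupp.single () m)) _ = _ from this, smul_zero]
  have hit0 : ∀ n, PowerSeries.constantCoeff (T^[n] 0) = 0 := by
    intro n
    induction n with
    | zero => simp
    | succ k ih => rw [Function.iterate_succ_apply']; exact hT0 _ ih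
  have hstep : ∀ n, (PowerSeries.X : PowerSeries R) ^ n ∣ T^[n + 1] 0 - T^[n] 0 := by
    intro n
    induction n with
    | zero => simp
    | succ k ih =>
      rw [Function.iterate_succ_apply' T (k + 1), Function.iterate_succ_apply' T k]
      exact key k _ _ (by rw [← Function.iterate_succ_apply' T k]; exact hit0 _) (hit0 _)
        (by rw [← Function.iterate_succ_apply' T k]; exact ih)
  have hstab : ∀ m n, (PowerSeries.X : PowerSeries R) ^ n ∣ T^[n + m] 0 - T^[n] 0 := by
    intro m n
    induction m with
    | zero => simp
    | succ k ih =>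
      have h := (pow_dvd_pow (PowerSeries.X : PowerSeries R) (Nat.le_add_right n k)).trans
        (hstep (n + k))
      have := dvd_add h ih
      rwa [sub_add_sub_cancel] at this
  set i : PowerSeries R := PowerSeries.mk fun n => PowerSeries.coeff n (T^[n + 1] 0) with hi
  have hi0 : PowerSeries.constantCoeff i = 0 := by
    rw [← PowerSeries.coeff_zero_eq_constantCoeff_apply, hi, PowerSeries.coeff_mk,
      PowerSeries.coeff_zero_eq_constantCoeff_apply]
    exact hit0 1
  have hclose : ∀ n, (PowerSeries.X : PowerSeries R) ^ n ∣ i - T^[n] 0 := by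
    intro n
    rw [PowerSeries.X_pow_dvd_iff]
    intro m hm
    obtain ⟨k, rfl⟩ := Nat.exists_eq_add_of_lt hm
    have h := PowerSeries.X_pow_dvd_iff.mp (hstab k (m + 1)) m (Nat.lt_succ_self m)
    rw [map_sub, sub_eq_zero] at h ⊢
    rw [hi, PowerSeries.coeff_mk, ← h, show m + k + 1 = m + 1 + k by ring]
  have hfix : T i = i := by
    rw [← sub_eq_zero]
    ext m
    have h1 := key m i _ hi0 (hit0 m) (hclose m)
    rw [← Function.iterate_succ_apply' T m] at h1
    have h2 := PowerSeries.X_pow_dvd_iff.mp (dvd_sub h1 (hclose (m + 1))) m (Nat.lt_succ_self m)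
    rw [sub_sub_sub_cancel_right] at h2
    rw [h2, map_zero]
  exact ⟨i, hi0, by simpa [hT] using hfix⟩

theorem add_inverse {R τ : Type*} [CommRing R] (F : FormalGroup R) {u : MvPowerSeries τ R}
    (hu : PowerSeries.HasSubst u) :
    MvPowerSeries.subst ![u, PowerSeries.subst u F.exists_inverse.choose] F.toPowerSeries = 0 := by
  obtain ⟨h0, hinv⟩ := F.exists_inverse.choose_spec
  have h := congrArg (PowerSeries.subst u) hinv
  rw [← PowerSeries.coe_substAlgHom hu, map_zero, PowerSeries.coe_substAlgHom hu,
    PowerSeries.subst, subst_add_point F PowerSeries.HasSubst.X'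
      (PowerSeries.HasSubst.of_constantCoeff_zero' h0) hu.const] at h
  have hX := PowerSeries.subst_X (R := R) hu
  rw [PowerSeries.subst] at hX
  rw [hX] at h
  exact h

/-- An endomorphism of the formal group law `F` over `R`: a power series `f ∈ R⟦X⟧` with `f(0) = 0`
and `f(F(X, Y)) = F(f(X), f(Y))`. -/
@[ext]
structure End {R : Type*} [CommRing R] (F : FormalGroup R) where
  toPowerSeries : PowerSeries R
  constantCoeff_eq_zero : PowerSeries.constantCoeff toPowerSeries = 0
  map_add_eq : PowerSeries.subst F.toPowerSeries toPowerSeries =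
    MvPowerSeries.subst ![PowerSeries.subst (MvPowerSeries.X 0) toPowerSeries,
      PowerSeries.subst (MvPowerSeries.X 1) toPowerSeries] F.toPowerSeries

namespace End

variable {R : Type*} [CommRing R] {F : FormalGroup R}

theorem hasSubst (f : F.End) : PowerSeries.HasSubst f.toPowerSeries :=
  PowerSeries.HasSubst.of_constantCoeff_zero' f.constantCoeff_eq_zero

theorem subst_add {τ : Type*} (f : F.End) {u v : MvPowerSeries τ R}
    (hu : PowerSeries.HasSubst u) (hv : PowerSeries.HasSubst v) :
    PowerSeries.subst (MvPowerSeries.subst ![u, v] F.toPowerSeries) f.toPowerSeries =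
      MvPowerSeries.subst ![PowerSeries.subst u f.toPowerSeries,
        PowerSeries.subst v f.toPowerSeries] F.toPowerSeries := by
  have hF : PowerSeries.HasSubst F.toPowerSeries :=
    PowerSeries.HasSubst.of_constantCoeff_zero F.zero_constantCoeff
  have huv := hasSubst_pair hu hv
  have h := congrArg (MvPowerSeries.subst ![u, v]) f.map_add_eq
  rw [subst_add_point F (hasSubst_subst f.constantCoeff_eq_zero (PowerSeries.HasSubst.X 0))
    (hasSubst_subst f.constantCoeff_eq_zero (PowerSeries.HasSubst.X 1)) huv] at h
  simp only [PowerSeries.subst] at h ⊢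
  rw [MvPowerSeries.subst_comp_subst_apply hF.const huv,
    MvPowerSeries.subst_comp_subst_apply (PowerSeries.HasSubst.X 0).const huv,
    MvPowerSeries.subst_comp_subst_apply (PowerSeries.HasSubst.X 1).const huv] at h
  simpa [MvPowerSeries.subst_X huv] using h

/-- The zero endomorphism. -/
instance : Zero F.End where
  zero :=
    { toPowerSeries := 0
      constantCoeff_eq_zero := map_zero _
      map_add_eq := by
        have h : ∀ a : MvPowerSeries (Fin 2) R, PowerSeries.HasSubst a →
            PowerSeries.subst a (0 : PowerSeries R) = 0 := fun a ha => by
          rw [← PowerSeries.coe_substAlgHom ha, map_zero]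
        rw [h _ (PowerSeries.HasSubst.of_constantCoeff_zero F.zero_constantCoeff),
          h _ (PowerSeries.HasSubst.X 0), h _ (PowerSeries.HasSubst.X 1),
          F.add_zero PowerSeries.HasSubst.zero] }

/-- The identity endomorphism. -/
noncomputable instance : One F.End where
  one :=
    { toPowerSeries := PowerSeries.X
      constantCoeff_eq_zero := PowerSeries.constantCoeff_X
      map_add_eq := by
        rw [PowerSeries.subst_X (PowerSeries.HasSubst.of_constantCoeff_zero F.zero_constantCoeff),
          PowerSeries.subst_X (PowerSeries.HasSubst.X 0),
          PowerSeries.subst_X (PowerSeries.HasSubst.X 1)]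
        have h : ![MvPowerSeries.X 0, MvPowerSeries.X 1] =
            (MvPowerSeries.X : Fin 2 → MvPowerSeries (Fin 2) R) := by
          funext s
          fin_cases s <;> rfl
        rw [h, MvPowerSeries.subst_self, id] }

/-- The product of two endomorphisms is their composite `f(g(X))`. -/
noncomputable instance : Mul F.End where
  mul f g :=
    { toPowerSeries := PowerSeries.subst g.toPowerSeries f.toPowerSeries
      constantCoeff_eq_zero :=
        MvPowerSeries.constantCoeff_subst_eq_zero g.hasSubst.const
          (fun _ => g.constantCoeff_eq_zero) f.constantCoeff_eq_zero
      map_add_eq := by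
        have hF := PowerSeries.HasSubst.of_constantCoeff_zero F.zero_constantCoeff
        rw [PowerSeries.subst_comp_subst_apply g.hasSubst hF,
          PowerSeries.subst_comp_subst_apply g.hasSubst (PowerSeries.HasSubst.X 0),
          PowerSeries.subst_comp_subst_apply g.hasSubst (PowerSeries.HasSubst.X 1), g.map_add_eq,
          f.subst_add (hasSubst_subst g.constantCoeff_eq_zero (PowerSeries.HasSubst.X 0))
            (hasSubst_subst g.constantCoeff_eq_zero (PowerSeries.HasSubst.X 1))] }

/-- The sum of two endomorphisms of a commutative formal group law is `F(f(X), g(X))`. -/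
noncomputable instance [F.IsComm] : Add F.End where
  add f g :=
    { toPowerSeries := MvPowerSeries.subst ![f.toPowerSeries, g.toPowerSeries] F.toPowerSeries
      constantCoeff_eq_zero := by
        refine MvPowerSeries.constantCoeff_subst_eq_zero (hasSubst_pair f.hasSubst g.hasSubst)
          (fun s => ?_) F.zero_constantCoeff
        fin_cases s
        · exact f.constantCoeff_eq_zero
        · exact g.constantCoeff_eq_zero
      map_add_eq := by
        have hF := PowerSeries.HasSubst.of_constantCoeff_zero F.zero_constantCoeff
        have h : ∀ a : MvPowerSeries (Fin 2) R, PowerSeries.HasSubst a →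
            PowerSeries.subst a
              (MvPowerSeries.subst ![f.toPowerSeries, g.toPowerSeries] F.toPowerSeries :
                PowerSeries R) =
            MvPowerSeries.subst ![PowerSeries.subst a f.toPowerSeries,
              PowerSeries.subst a g.toPowerSeries] F.toPowerSeries := fun a ha =>
          subst_add_point F f.hasSubst g.hasSubst ha.const
        have hX (f : F.End) (s : Fin 2) : PowerSeries.HasSubst
            (PowerSeries.subst (MvPowerSeries.X s : MvPowerSeries (Fin 2) R) f.toPowerSeries) :=
          hasSubst_subst f.constantCoeff_eq_zero (PowerSeries.HasSubst.X s)
        rw [h _ hF, h _ (PowerSeries.HasSubst.X 0), h _ (PowerSeries.HasSubst.X 1), f.map_add_eq,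
          g.map_add_eq]
        let P (f : F.End) (s : Fin 2) : F.Point (Fin 2) := ⟨_, hX f s⟩
        exact congrArg Subtype.val (add_add_add_comm (P f 0) (P f 1) (P g 0) (P g 1)) }

/-- The negative of an endomorphism `f`: the power series `i(f(X))`, where `F(X, i(X)) = 0`. -/
noncomputable instance [F.IsComm] : Neg F.End where
  neg f :=
    { toPowerSeries := PowerSeries.subst f.toPowerSeries F.exists_inverse.choose
      constantCoeff_eq_zero :=
        MvPowerSeries.constantCoeff_subst_eq_zero f.hasSubst.const
          (fun _ => f.constantCoeff_eq_zero) F.exists_inverse.choose_spec.1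
      map_add_eq := by
        have h0 := F.exists_inverse.choose_spec.1
        set i := F.exists_inverse.choose
        have hF := PowerSeries.HasSubst.of_constantCoeff_zero F.zero_constantCoeff
        have hX (s : Fin 2) : PowerSeries.HasSubst
            (PowerSeries.subst (MvPowerSeries.X s : MvPowerSeries (Fin 2) R) f.toPowerSeries) :=
          hasSubst_subst f.constantCoeff_eq_zero (PowerSeries.HasSubst.X s)
        rw [PowerSeries.subst_comp_subst_apply f.hasSubst hF,
          PowerSeries.subst_comp_subst_apply f.hasSubst (PowerSeries.HasSubst.X 0),
          PowerSeries.subst_comp_subst_apply f.hasSubst (PowerSeries.HasSubst.X 1), f.map_add_eq]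
        let P (s : Fin 2) : F.Point (Fin 2) := ⟨_, hX s⟩
        let N (Q : F.Point (Fin 2)) : F.Point (Fin 2) := ⟨_, hasSubst_subst h0 Q.2⟩
        have hN (Q : F.Point (Fin 2)) : Q + N Q = 0 := Subtype.ext (F.add_inverse Q.2)
        have : N (P 0 + P 1) = N (P 0) + N (P 1) := by
          refine left_neg_eq_right_neg (a := P 0 + P 1) ?_ ?_
          · rw [add_comm, hN]
          · rw [add_add_add_comm, hN, hN, _root_.add_zero]
        exact congrArg Subtype.val this }

/-- The differential `c : f ↦ f'(0)`. -/
noncomputable def c (f : F.End) : R := PowerSeries.coeff 1 f.toPowerSeries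

theorem c_zero : (0 : F.End).c = 0 := map_zero _

theorem c_one : (1 : F.End).c = 1 := PowerSeries.coeff_one_X

theorem coeff_one_subst {f g : PowerSeries R} (hg : PowerSeries.constantCoeff g = 0) :
    PowerSeries.coeff 1 (PowerSeries.subst g f : PowerSeries R) =
      PowerSeries.coeff 1 f * PowerSeries.coeff 1 g := by
  rw [PowerSeries.coeff_subst' (PowerSeries.HasSubst.of_constantCoeff_zero' hg),
    finsum_eq_single _ 1]
  · simp
  · intro d hd
    rcases Nat.eq_zero_or_pos d with rfl | h
    · simp [PowerSeries.coeff_one]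
    · have h2 : (PowerSeries.X : PowerSeries R) ^ 2 ∣ g ^ d :=
        (pow_dvd_pow_of_dvd (PowerSeries.X_dvd_iff.mpr hg) 2).trans (pow_dvd_pow g (by omega))
      rw [PowerSeries.X_pow_dvd_iff.mp h2 1 one_lt_two, smul_zero]

theorem c_mul (f g : F.End) : (f * g).c = f.c * g.c :=
  coeff_one_subst g.constantCoeff_eq_zero

theorem coeff_one_add (F : FormalGroup R) {f g : PowerSeries R}
    (hf : PowerSeries.constantCoeff f = 0) (hg : PowerSeries.constantCoeff g = 0) :
    PowerSeries.coeff 1 (MvPowerSeries.subst ![f, g] F.toPowerSeries : PowerSeries R) =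
      PowerSeries.coeff 1 f + PowerSeries.coeff 1 g := by
  classical
  have h := hasSubst_pair (PowerSeries.HasSubst.of_constantCoeff_zero' hf)
    (PowerSeries.HasSubst.of_constantCoeff_zero' hg)
  have hne : (Finsupp.single 0 1 : Fin 2 →₀ ℕ) ≠ Finsupp.single 1 1 := by
    intro h
    simpa using DFunLike.congr_fun h 0
  rw [PowerSeries.coeff, MvPowerSeries.coeff_subst h,
    finsum_eq_sum_of_support_subset (s := {Finsupp.single 0 1, Finsupp.single 1 1})]
  · rw [Finset.sum_pair hne]
    simp [F.lin_coeff_X, F.lin_coeff_Y]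
  · intro d hd
    by_contra hd'
    apply hd
    simp only [Finset.coe_insert, Finset.coe_singleton, Set.mem_insert_iff, Set.mem_singleton_iff,
      not_or] at hd'
    simp only [Finsupp.prod_fintype, pow_zero, implies_true, Fin.prod_univ_two,
        Matrix.cons_val_zero, Matrix.cons_val_one]
    rcases Nat.lt_or_ge (d 0 + d 1) 2 with h2 | h2
    · have : d = 0 := by
        have h0 : d 0 = 0 := by
          by_contra h0
          apply hd'.1
          ext s
          fin_cases s
          · simp; omega
          · simp; omega
        have h1 : d 1 = 0 := by
          by_contra h1
          apply hd'.2
          ext s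
          fin_cases s
          · simp; omega
          · simp; omega
        ext s
        fin_cases s
        · exact h0
        · exact h1
      rw [this, MvPowerSeries.coeff_zero_eq_constantCoeff_apply, F.zero_constantCoeff, zero_smul]
    · have h3 : (PowerSeries.X : PowerSeries R) ^ 2 ∣ f ^ d 0 * g ^ d 1 := by
        refine (pow_dvd_pow _ h2).trans ?_
        rw [pow_add]
        exact mul_dvd_mul (pow_dvd_pow_of_dvd (PowerSeries.X_dvd_iff.mpr hf) _)
          (pow_dvd_pow_of_dvd (PowerSeries.X_dvd_iff.mpr hg) _)
      have := PowerSeries.X_pow_dvd_iff.mp h3 1 one_lt_two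
      rw [show MvPowerSeries.coeff _ _ = _ from this, smul_zero]

theorem c_add [F.IsComm] (f g : F.End) : (f + g).c = f.c + g.c :=
  coeff_one_add F f.constantCoeff_eq_zero g.constantCoeff_eq_zero

theorem c_neg [F.IsComm] (f : F.End) : (-f).c = -f.c := by
  obtain ⟨h0, hinv⟩ := F.exists_inverse.choose_spec
  have h := congrArg (PowerSeries.coeff 1) hinv
  rw [coeff_one_add F PowerSeries.constantCoeff_X h0, PowerSeries.coeff_one_X, map_zero] at h
  have h' : (-f).c = PowerSeries.coeff 1 F.exists_inverse.choose * f.c :=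
    coeff_one_subst f.constantCoeff_eq_zero
  rw [h', eq_neg_of_add_eq_zero_right h, neg_one_mul]

theorem eq_zero_of_c_eq_zero [IsDomain R] [CharZero R] (f : F.End) (hf : f.c = 0) :
    f.toPowerSeries = 0 := by
  classical
  have hF := PowerSeries.HasSubst.of_constantCoeff_zero F.zero_constantCoeff
  obtain ⟨G, hG⟩ : (MvPowerSeries.X 1 : MvPowerSeries (Fin 2) R) ∣
      F.toPowerSeries - MvPowerSeries.X 0 := by
    rw [MvPowerSeries.X_dvd_iff]
    intro m hm
    have hm' : m = Finsupp.single 0 (m 0) := by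
      ext s
      fin_cases s
      · simp
      · simpa using hm
    have h1 := congrArg (PowerSeries.coeff (m 0)) F.Xzero_eq_X
    rw [FormalGroup.Xzero, PowerSeries.coeff, MvPowerSeries.coeff_subst
      (hasSubst_pair PowerSeries.HasSubst.X' PowerSeries.HasSubst.zero'),
      finsum_eq_single _ m] at h1
    · simp only [Finsupp.prod_fintype, pow_zero, implies_true, Fin.prod_univ_two,
        Matrix.cons_val_zero, Matrix.cons_val_one, hm, mul_one] at h1
      have h2 : MvPowerSeries.coeff (Finsupp.single () (m 0))
          ((PowerSeries.X : PowerSeries R) ^ m 0) = 1 := PowerSeries.coeff_X_pow_self _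
      rw [h2, smul_eq_mul, mul_one] at h1
      rw [map_sub, h1, sub_eq_zero]
      change PowerSeries.coeff (m 0) PowerSeries.X = _
      rw [PowerSeries.coeff_X, MvPowerSeries.coeff_X]
      congr 1
      rw [eq_iff_iff]
      constructor
      · intro h
        rw [hm', h]
      · intro h
        rw [h]
        simp
    · intro d hd
      simp only [Finsupp.prod_fintype, pow_zero, implies_true, Fin.prod_univ_two,
        Matrix.cons_val_zero, Matrix.cons_val_one]
      rcases Nat.eq_zero_or_pos (d 1) with h3 | h3
      · have h4 : d 0 ≠ m 0 := by
          intro h4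
          apply hd
          ext s
          fin_cases s
          · exact h4
          · exact h3.trans hm.symm
        have h5 : MvPowerSeries.coeff (Finsupp.single () (m 0))
            ((PowerSeries.X : PowerSeries R) ^ d 0) = 0 := by
          change PowerSeries.coeff (m 0) _ = 0
          rw [PowerSeries.coeff_X_pow, if_neg h4.symm]
        rw [h3, pow_zero, mul_one, h5, smul_zero]
      · rw [zero_pow h3.ne', mul_zero, map_zero, smul_zero]
  have hG0 : MvPowerSeries.constantCoeff G = 1 := by
    have h := congrArg (MvPowerSeries.coeff (Finsupp.single 1 1)) hG
    rw [map_sub, F.lin_coeff_Y, MvPowerSeries.coeff_X, if_neg (by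
      intro h
      simpa using DFunLike.congr_fun h 0), sub_zero, ← mul_one (MvPowerSeries.X 1 * G),
      mul_one, ← _root_.add_zero (Finsupp.single 1 1), MvPowerSeries.X,
      MvPowerSeries.coeff_add_monomial_mul] at h
    simpa using h.symm
  rw [sub_eq_iff_eq_add'] at hG
  ext n
  rw [map_zero]
  induction n using Nat.strong_induction_on with
  | _ n ih =>
  match n with
  | 0 => rw [PowerSeries.coeff_zero_eq_constantCoeff_apply]; exact f.constantCoeff_eq_zero
  | 1 => exact hf
  | n + 2 =>
  set e : Fin 2 →₀ ℕ := Finsupp.single 1 1 + Finsupp.single 0 (n + 1) with he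
  have he1 : e 1 = 1 := by simp [he]
  have he0 : e 0 = n + 1 := by simp [he]
  have h := congrArg (MvPowerSeries.coeff e) f.map_add_eq
  rw [PowerSeries.coeff_subst hF, finsum_eq_single _ (n + 2),
    MvPowerSeries.coeff_subst (hasSubst_pair
      (hasSubst_subst f.constantCoeff_eq_zero (PowerSeries.HasSubst.X 0))
      (hasSubst_subst f.constantCoeff_eq_zero (PowerSeries.HasSubst.X 1))),
    finsum_eq_zero_of_forall_eq_zero] at h
  · have h2 : MvPowerSeries.coeff e (F.toPowerSeries ^ (n + 2)) = ((n + 2 : ℕ) : R) := by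
      obtain ⟨k, hk⟩ := Polynomial.powAddExpansion (MvPowerSeries.X 0)
        (MvPowerSeries.X 1 * G) (n + 2)
      rw [hG, hk]
      have e1 : MvPowerSeries.coeff e ((MvPowerSeries.X 0 : MvPowerSeries (Fin 2) R) ^ (n + 2)) =
          0 := by
        rw [MvPowerSeries.coeff_X_pow, if_neg]
        intro h
        have := DFunLike.congr_fun h 1
        rw [he1] at this
        simp at this
      have e2 : MvPowerSeries.coeff e (k * (MvPowerSeries.X 1 * G) ^ 2) = 0 :=
        MvPowerSeries.X_pow_dvd_iff.mp
          ((dvd_mul_of_dvd_left (dvd_refl _) _ : MvPowerSeries.X 1 ^ 2 ∣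
            MvPowerSeries.X 1 ^ 2 * (G ^ 2 * k)).trans (dvd_of_eq (by ring))) e (by omega)
      have e3 : MvPowerSeries.coeff e (((n + 2 : ℕ) : MvPowerSeries (Fin 2) R) *
          MvPowerSeries.X 0 ^ (n + 2 - 1) * (MvPowerSeries.X 1 * G)) = ((n + 2 : ℕ) : R) := by
        have : ((n + 2 : ℕ) : MvPowerSeries (Fin 2) R) *
          MvPowerSeries.X 0 ^ (n + 2 - 1) * (MvPowerSeries.X 1 * G) =
          MvPowerSeries.monomial e 1 * (((n + 2 : ℕ) : MvPowerSeries (Fin 2) R) * G) := by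
          rw [he, show (1 : R) = 1 * 1 by simp, ← MvPowerSeries.monomial_mul_monomial,
            ← MvPowerSeries.X, ← MvPowerSeries.X_pow_eq, Nat.add_sub_assoc (by norm_num)]
          ring
        have h7 := MvPowerSeries.coeff_add_monomial_mul e 0
          (((n + 2 : ℕ) : MvPowerSeries (Fin 2) R) * G) (1 : R)
        rw [_root_.add_zero] at h7
        rw [this, h7, one_mul, MvPowerSeries.coeff_zero_eq_constantCoeff_apply, map_mul,
          map_natCast, hG0, mul_one]
      rw [map_add, map_add, e1, e2, e3, _root_.zero_add, _root_.add_zero]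
    rw [h2, smul_eq_mul, mul_eq_zero] at h
    exact h.resolve_right (Nat.cast_ne_zero.mpr (by omega))
  · intro d
    simp only [Finsupp.prod_fintype, pow_zero, implies_true, Fin.prod_univ_two,
        Matrix.cons_val_zero, Matrix.cons_val_one]
    rcases Nat.eq_zero_or_pos (d 1) with h3 | h3
    · rw [h3, pow_zero, mul_one, ← PowerSeries.subst_pow (PowerSeries.HasSubst.X 0),
        PowerSeries.coeff_subst_single, if_neg, smul_zero]
      intro h
      have := DFunLike.congr_fun h 1
      rw [he1] at this
      simp at this
    · obtain ⟨g, hg⟩ : (PowerSeries.X : PowerSeries R) ^ 2 ∣ f.toPowerSeries := by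
        rw [PowerSeries.X_pow_dvd_iff]
        intro m hm
        interval_cases m
        · rw [PowerSeries.coeff_zero_eq_constantCoeff_apply]; exact f.constantCoeff_eq_zero
        · exact hf
      have h4 : (MvPowerSeries.X 1 : MvPowerSeries (Fin 2) R) ^ 2 ∣
          PowerSeries.subst (MvPowerSeries.X 1 : MvPowerSeries (Fin 2) R) f.toPowerSeries := by
        rw [hg, PowerSeries.subst_mul (PowerSeries.HasSubst.X 1),
          PowerSeries.subst_pow (PowerSeries.HasSubst.X 1),
          PowerSeries.subst_X (PowerSeries.HasSubst.X 1)]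
        exact dvd_mul_right _ _
      have h5 := MvPowerSeries.X_pow_dvd_iff.mp
        ((h4.trans (dvd_pow_self _ h3.ne')).trans
          (dvd_mul_left _ (PowerSeries.subst (MvPowerSeries.X 0 : MvPowerSeries (Fin 2) R)
            f.toPowerSeries ^ d 0))) e (by omega)
      rw [h5, smul_zero]
  · intro d hd
    rcases Nat.lt_or_gt_of_ne hd with h3 | h3
    · rw [ih d h3, zero_smul]
    · rw [MvPowerSeries.coeff_eq_zero_of_constantCoeff_nilpotent (m := 1), smul_zero]
      · rw [F.zero_constantCoeff, pow_one]
      · have : e.degree = n + 2 := by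
          rw [he]
          simp [Finsupp.degree_eq_sum]
        omega

/-- Over a domain of characteristic zero an endomorphism is determined by its differential. -/
theorem c_injective [IsDomain R] [CharZero R] [F.IsComm] :
    Function.Injective (c : F.End → R) := by
  intro f g hfg
  have h0 : (f + -g).toPowerSeries = 0 :=
    eq_zero_of_c_eq_zero _ (by rw [c_add, c_neg, hfg, add_neg_cancel])
  let P (f : F.End) : F.Point Unit := ⟨f.toPowerSeries, f.hasSubst⟩
  have h1 : P f + P (-g) = 0 := Subtype.ext h0
  have h2 : P (-g) + P g = 0 := by
    rw [add_comm]
    exact Subtype.ext (F.add_inverse g.hasSubst)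
  have h3 : P f = P g := left_neg_eq_right_neg h1 h2
  exact End.ext (congrArg Subtype.val h3)

/-- The endomorphisms of a commutative formal group law over a domain of characteristic zero form a
commutative ring, with addition `F(f(X), g(X))` and with composition as multiplication. -/
noncomputable instance [IsDomain R] [CharZero R] [F.IsComm] : CommRing F.End where
  add_assoc f g h := c_injective (by simp only [c_add, add_assoc])
  zero_add f := c_injective (by rw [c_add, c_zero, _root_.zero_add])
  add_zero f := c_injective (by rw [c_add, c_zero, _root_.add_zero])
  add_comm f g := c_injective (by rw [c_add, c_add, add_comm])
  neg_add_cancel f := c_injective (by rw [c_add, c_neg, c_zero, neg_add_cancel])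
  mul_assoc f g h := c_injective (by simp only [c_mul, mul_assoc])
  one_mul f := c_injective (by rw [c_mul, c_one, one_mul])
  mul_one f := c_injective (by rw [c_mul, c_one, mul_one])
  mul_comm f g := c_injective (by rw [c_mul, c_mul, mul_comm])
  zero_mul f := c_injective (by rw [c_mul, c_zero, zero_mul])
  mul_zero f := c_injective (by rw [c_mul, c_zero, mul_zero])
  left_distrib f g h := c_injective (by simp only [c_mul, c_add, mul_add])
  right_distrib f g h := c_injective (by simp only [c_mul, c_add, add_mul])
  nsmul := nsmulRec
  zsmul := zsmulRec

/-- The differential as a ring homomorphism. -/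
noncomputable def cHom [IsDomain R] [CharZero R] (F : FormalGroup R) [F.IsComm] : F.End →+* R where
  toFun := c
  map_zero' := c_zero
  map_one' := c_one
  map_add' := c_add
  map_mul' := c_mul

instance [IsDomain R] [CharZero R] [F.IsComm] : IsDomain F.End :=
  Function.Injective.isDomain (cHom F) c_injective

end End

instance map_isComm {R S : Type*} [CommRing R] [CommRing S] (F : FormalGroup R) [F.IsComm]
    (φ : R →+* S) : (F.map φ).IsComm where
  comm := by
    have h : ![MvPowerSeries.X 1, MvPowerSeries.X 0] = fun i =>
        MvPowerSeries.map φ ((![MvPowerSeries.X 1, MvPowerSeries.X 0] :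
          Fin 2 → MvPowerSeries (Fin 2) R) i) := by
      funext s
      fin_cases s <;> simp
    rw [map_toPowerSeries, h, ← MvPowerSeries.map_subst .X_X, ← IsComm.comm]

/-- Base change of endomorphisms along `φ : R → S`, applied coefficientwise, where `G` is the
formal group law over `S` obtained from `F` by applying `φ` to the coefficients. -/
noncomputable def End.map {R S : Type*} [CommRing R] [IsDomain R] [CharZero R] [CommRing S]
    [IsDomain S] [CharZero S] (F : FormalGroup R) [F.IsComm] (φ : R →+* S) (G : FormalGroup S)
    [G.IsComm] (hG : G = F.map φ) : F.End →+* G.End :=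
  let m (f : F.End) : G.End :=
    { toPowerSeries := PowerSeries.map φ f.toPowerSeries
      constantCoeff_eq_zero := by
        rw [← PowerSeries.coeff_zero_eq_constantCoeff_apply, PowerSeries.coeff_map,
          PowerSeries.coeff_zero_eq_constantCoeff_apply, f.constantCoeff_eq_zero, map_zero]
      map_add_eq := by
        have h (s : Fin 2) : PowerSeries.subst (MvPowerSeries.X s : MvPowerSeries (Fin 2) S)
            (PowerSeries.map φ f.toPowerSeries) =
            MvPowerSeries.map φ (PowerSeries.subst (MvPowerSeries.X s) f.toPowerSeries) := by
          rw [PowerSeries.map_subst (PowerSeries.HasSubst.X s), MvPowerSeries.map_X]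
        have h' : ![MvPowerSeries.map φ (PowerSeries.subst (MvPowerSeries.X 0) f.toPowerSeries),
            MvPowerSeries.map φ (PowerSeries.subst (MvPowerSeries.X 1) f.toPowerSeries)] =
            fun i => MvPowerSeries.map φ ((![PowerSeries.subst (MvPowerSeries.X 0) f.toPowerSeries,
              PowerSeries.subst (MvPowerSeries.X 1) f.toPowerSeries] :
                Fin 2 → MvPowerSeries (Fin 2) R) i) := by
          funext s
          fin_cases s <;> rfl
        rw [hG, map_toPowerSeries, ← PowerSeries.map_subst
          (PowerSeries.HasSubst.of_constantCoeff_zero F.zero_constantCoeff), f.map_add_eq, h, h,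
          h', ← MvPowerSeries.map_subst (hasSubst_pair
            (hasSubst_subst f.constantCoeff_eq_zero (PowerSeries.HasSubst.X 0))
            (hasSubst_subst f.constantCoeff_eq_zero (PowerSeries.HasSubst.X 1)))] }
  have hm (f : F.End) : (m f).c = φ f.c := PowerSeries.coeff_map _ _ _
  { toFun := m
    map_zero' := End.c_injective (by rw [hm, End.c_zero, End.c_zero, map_zero])
    map_one' := End.c_injective (by rw [hm, End.c_one, End.c_one, map_one])
    map_add' := fun f g => End.c_injective (by rw [hm, End.c_add, End.c_add, hm, hm, map_add])
    map_mul' := fun f g => End.c_injective (by rw [hm, End.c_mul, End.c_mul, hm, hm, map_mul]) }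

end FormalGroup

/-- A (one-dimensional, commutative) formal `A`-module over the `A`-algebra `R` with structure map
`φ : A → R`: a commutative formal group law `F` over `R` with a ring homomorphism
`a ↦ [a]` from `A` to `End F` such that `[a](X) = φ(a) X + ⋯`. -/
structure FormalModule {A R : Type*} [CommRing A] [CommRing R] [IsDomain R] [CharZero R]
    (φ : A →+* R) where
  toFormalGroup : FormalGroup R
  [isComm : toFormalGroup.IsComm]
  act : A →+* toFormalGroup.End
  c_act : ∀ a : A, (act a).c = φ a

attribute [instance] FormalModule.isComm

/-- Finite height with respect to a generator `ϖ` of the maximal ideal of `A`: some coefficient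
`aᵢ`, `i ≥ 2`, of `[ϖ](X) = ϖ X + a₂ X² + ⋯` is a unit. -/
def FormalModule.HasFiniteHeight {A R : Type*} [CommRing A] [CommRing R] [IsDomain R] [CharZero R]
    {φ : A →+* R} (M : FormalModule φ) (ϖ : A) : Prop :=
  ∃ i, 2 ≤ i ∧ IsUnit (PowerSeries.coeff i (M.act ϖ).toPowerSeries)

/-! ### Subfields of a valued field containing `ℚ_p`

`Ω` is a field with an ultrametric absolute value extending the one of `ℚ_p`; its subfields carry
the restricted absolute value. -/

namespace PadicSubfield

variable {p : ℕ} [Fact p.Prime] {Ω : Type*} [NormedField Ω] [NormedAlgebra ℚ_[p] Ω]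
  [IsUltrametricDist Ω]

/-- The ring of integers `{x ∈ k | ‖x‖ ≤ 1}` of a subfield `k` of `Ω`. -/
noncomputable abbrev integers (k : IntermediateField ℚ_[p] Ω) : ValuationSubring k :=
  (NormedField.valuation (K := k)).valuationSubring

/-- The inclusion `O_E ⊆ O_k` for `E ⊆ k`. -/
noncomputable def inclusion {E k : IntermediateField ℚ_[p] Ω} (h : E ≤ k) :
    integers E →+* integers k :=
  ((IntermediateField.inclusion h).toRingHom.comp (integers E).subtype).codRestrict (integers k)
    fun x => x.2

/-- The inclusion `O_k ⊆ Ω`. -/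
noncomputable def toAmbient (k : IntermediateField ℚ_[p] Ω) : integers k →+* Ω :=
  (algebraMap k Ω).comp (integers k).subtype

/-- `E / K` is unramified: the maximal ideal of `O_K` generates that of `O_E`. (For finite
extensions of `ℚ_p` the residue extension is automatically separable.) -/
def IsUnramified {K E : IntermediateField ℚ_[p] Ω} (h : K ≤ E) : Prop :=
  (IsLocalRing.maximalIdeal (integers K)).map (inclusion h) =
    IsLocalRing.maximalIdeal (integers E)

/-- `k` is a complete discrete valuation field for the absolute value of `Ω`. -/
structure IsCompleteDiscretelyValued (k : IntermediateField ℚ_[p] Ω) : Prop where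
  isComplete : IsComplete (k : Set Ω)
  isDiscreteValuationRing : IsDiscreteValuationRing (integers k)

open scoped IntermediateField in
/-- The field `K_π = ℚ_p(π)`. -/
noncomputable abbrev adjoinUniformizer {K : IntermediateField ℚ_[p] Ω} (π : integers K) :
    IntermediateField ℚ_[p] Ω :=
  ℚ_[p]⟮(toAmbient K π : Ω)⟯

theorem adjoinUniformizer_le {K E : IntermediateField ℚ_[p] Ω} (h : K ≤ E) (π : integers K) :
    adjoinUniformizer π ≤ E :=
  (IntermediateField.adjoin_simple_le_iff.mpr π.1.2).trans h

/-- The element `π` of the ring of integers `A_π` of `ℚ_p(π)`. -/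
noncomputable def uniformizer {K : IntermediateField ℚ_[p] Ω} (π : integers K) :
    integers (adjoinUniformizer π) :=
  ⟨IntermediateField.AdjoinSimple.gen ℚ_[p] (toAmbient K π : Ω), π.2⟩

/-- The ring `End_{O_k}(F)` of endomorphisms of `F` defined over `O_k`, where `F` is a formal group
law over `O_E` and `E ⊆ k ⊆ Ω`, viewed as a ring of power series with coefficients in `Ω`. -/
noncomputable def endOver [CharZero Ω] {E : IntermediateField ℚ_[p] Ω}
    (F : FormalGroup (integers E)) [F.IsComm] (k : IntermediateField ℚ_[p] Ω) (h : E ≤ k) :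
    Subring (F.map (toAmbient E)).End :=
  (FormalGroup.End.map (F.map (inclusion h)) (toAmbient k) (F.map (toAmbient E)) (by
    refine FormalGroup.ext ?_
    simp only [FormalGroup.map_toPowerSeries]
    ext n
    rfl)).range

/-- The absolute endomorphism ring of `F`: the ring generated by the `End_{O_k}(F)`, where `k`
ranges over the complete discrete valuation fields with `E ⊆ k ⊆ Ω`. -/
noncomputable def absoluteEnd [CharZero Ω] {E : IntermediateField ℚ_[p] Ω}
    (F : FormalGroup (integers E)) [F.IsComm] : Subring (F.map (toAmbient E)).End :=
  ⨆ (k : IntermediateField ℚ_[p] Ω) (h : E ≤ k) (_ : IsCompleteDiscretelyValued k), endOver F k h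

end PadicSubfield

open PadicSubfield

/-! Since `E / K` is unramified, `π` generates the maximal ideal of `O_E`. Hence `P = [π]` has the
form `X (π A + X ^ n U)` with `A(0) = 1` and `U` a unit, `n + 1` being the least degree at least 2
in which `[π]` has a unit coefficient. This shape survives extension of scalars to `O_k` for every
`k ⊇ E`, in particular for `k = Ω`. The differential `c` embeds each endomorphism ring in its
coefficient ring, so these rings are commutative domains and every endomorphism commutes with `P`.

The heart is a division principle. If `c f` is not a unit, comparing `f ∘ P` with `P ∘ f` shows that
`P` divides `f` as a power series (`dvd_of_commute`). Then `f` is even a series in `P`, and the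
quotient is an endomorphism (`exists_eq_mul_of_dvd`): this plays the role of passing to the quotient
by the kernel of `P`. Divisibility of `c f` by all powers of `π` forces `f = 0`, so every nonzero
endomorphism is a unit times a power of `P`. The endomorphism ring over `O_k` is therefore a
valuation ring, hence integrally closed, with no discreteness assumption on `k`.

It remains to see that the union is the single ring over `O_Ω`. Commutation also gives `c f ^ (n +
1) ≡ c f` modulo `π`, so the differentials have finitely many residues. Dividing by `P` repeatedly
expands `c f` in powers of `π` with finitely many digits; thus `c f` lies in a finite-dimensional,
hence closed, `E`-subspace of `Ω` and is algebraic (`isIntegral_c`). Commutation with `P` determines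
all coefficients of `f` rationally from `c f` and those of `P`, so `f` is defined over the finite
extension `E(c f)`, which is complete and discretely valued (`exists_mem_endOver`). -/

namespace MvPowerSeries

/-! ### Cancelling a constant in divisibility of power series. -/

variable {R : Type*} [CommRing R] {τ : Type*}

theorem C_dvd_iff {a : R} {f : MvPowerSeries τ R} : C a ∣ f ↔ ∀ e, a ∣ coeff e f := by
  constructor
  · rintro ⟨g, rfl⟩ e
    rw [coeff_C_mul]
    exact dvd_mul_right _ _
  · intro h
    choose b hb using h
    let g : MvPowerSeries τ R := b
    exact ⟨g, by ext e; rw [coeff_C_mul, hb]; rfl⟩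

theorem C_dvd_of_C_dvd_X_pow_mul {a : R} (t : τ) (m : ℕ) {f : MvPowerSeries τ R}
    (h : C a ∣ X t ^ m * f) : C a ∣ f := by
  rw [C_dvd_iff] at h ⊢
  intro e
  have := h (Finsupp.single t m + e)
  rwa [X_pow_eq, coeff_add_monomial_mul, one_mul] at this

/-- Modulo `π` the divisor is `X t ^ m` times a unit, and multiplication by it reflects divisibility
by `π`. So the cofactor `s` in `π g = (π a + X t ^ m u) s` is a multiple of `π`, and `π` cancels. -/
theorem dvd_of_dvd_C_mul [IsDomain R] {π : R} (hπ : π ≠ 0) (t : τ) (m : ℕ)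
    {a u g : MvPowerSeries τ R} (hu : IsUnit u) (h : C π * a + X t ^ m * u ∣ C π * g) :
    C π * a + X t ^ m * u ∣ g := by
  obtain ⟨s, hs⟩ := h
  have h1 : C π ∣ X t ^ m * (u * s) := ⟨g - a * s, by linear_combination -hs⟩
  obtain ⟨s', hs'⟩ := (hu.dvd_mul_left).mp (C_dvd_of_C_dvd_X_pow_mul t m h1)
  refine ⟨s', ?_⟩
  have hC : (C π : MvPowerSeries τ R) ≠ 0 := by
    intro h0
    apply hπ
    simpa using congrArg constantCoeff h0
  apply mul_left_cancel₀ hC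
  rw [hs, hs']
  ring

end MvPowerSeries

/-! ### Eisenstein series and the series that commute with them. -/

namespace PowerSeries

variable {R : Type*} [CommRing R]

/-- The series `p = X (π A + X ^ n U)` with `A(0) = 1` and `U(0)` a unit: all coefficients of degree
at most `n` are divisible by `π`, the first one is `π`, and the one of degree `n + 1` is a unit. -/
def IsEisensteinSeries (p : R⟦X⟧) (π : R) (n : ℕ) : Prop :=
  ∃ A U : R⟦X⟧, p = X * (C π * A + X ^ n * U) ∧ constantCoeff A = 1 ∧ IsUnit U

theorem isEisensteinSeries_of_coeff {p : R⟦X⟧} {π : R} {n : ℕ} (hn : n ≠ 0)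
    (h0 : constantCoeff p = 0) (h1 : coeff 1 p = π)
    (hlt : ∀ i, 2 ≤ i → i < n + 1 → π ∣ coeff i p) (hu : IsUnit (coeff (n + 1) p)) :
    IsEisensteinSeries p π n := by
  classical
  choose b hb using hlt
  -- The factor `X` in front shifts indices by one. `A` is a polynomial of degree below `n`
  -- collecting the quotients by `π`, with padding 0; everything from degree `n + 1` on goes into
  -- `U`.
  refine ⟨mk fun i => if i = 0 then 1 else
    if h : 2 ≤ i + 1 ∧ i + 1 < n + 1 then b (i + 1) h.1 h.2 else 0,
    mk fun i => coeff (i + (n + 1)) p, ?_, ?_, ?_⟩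
  · ext i
    rcases i with _ | i
    · simp [h0]
    rw [coeff_succ_X_mul, map_add, coeff_C_mul, coeff_mk, coeff_X_pow_mul', coeff_mk]
    rcases Nat.eq_zero_or_pos i with rfl | hi
    · simp [h1, hn]
    rw [if_neg hi.ne']
    rcases Nat.lt_or_ge i n with h | h
    · rw [dif_pos ⟨by omega, by omega⟩, if_neg (by omega), ← hb, add_zero]
    · rw [dif_neg (by omega), if_pos h, mul_zero, zero_add]
      congr 2
      omega
  · rw [← coeff_zero_eq_constantCoeff_apply, coeff_mk, if_pos rfl]
  · rw [isUnit_iff_constantCoeff, ← coeff_zero_eq_constantCoeff_apply, coeff_mk, zero_add]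
    exact hu

namespace IsEisensteinSeries

variable {p : R⟦X⟧} {π : R} {n : ℕ}

theorem constantCoeff_eq_zero (hp : IsEisensteinSeries p π n) : constantCoeff p = 0 := by
  obtain ⟨A, U, rfl, -, -⟩ := hp
  simp

theorem hasSubst (hp : IsEisensteinSeries p π n) : HasSubst p :=
  HasSubst.of_constantCoeff_zero' hp.constantCoeff_eq_zero

theorem coeff_one (hp : IsEisensteinSeries p π n) (hn : n ≠ 0) : coeff 1 p = π := by
  obtain ⟨A, U, rfl, hA, -⟩ := hp
  rw [show 1 = 0 + 1 from rfl, coeff_succ_X_mul]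
  simp [hA, hn]

theorem dvd_of_dvd_C_mul [IsDomain R] (hp : IsEisensteinSeries p π n) (hπ : π ≠ 0) {τ : Type*}
    (t : τ) {g : MvPowerSeries τ R}
    (h : subst (MvPowerSeries.X t : MvPowerSeries τ R) p ∣ MvPowerSeries.C π * g) :
    subst (MvPowerSeries.X t : MvPowerSeries τ R) p ∣ g := by
  obtain ⟨A, U, rfl, -, hU⟩ := hp
  have hX := HasSubst.X (S := R) t
  have e : subst (MvPowerSeries.X t : MvPowerSeries τ R) (X * (C π * A + X ^ n * U)) =
      MvPowerSeries.C π * (MvPowerSeries.X t * subst (MvPowerSeries.X t) A) +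
        MvPowerSeries.X t ^ (n + 1) * subst (MvPowerSeries.X t) U := by
    rw [subst_mul hX, subst_add hX, subst_mul hX, subst_mul hX, subst_pow hX, subst_X hX, subst_C]
    ring
  rw [e] at h ⊢
  refine MvPowerSeries.dvd_of_dvd_C_mul hπ t _ ?_ h
  rw [← coe_substAlgHom hX]
  exact hU.map _

/-- The relation between `p = X W` and a series `f = X t` that commutes with it. -/
theorem commute_relation [IsDomain R] {A U f t : R⟦X⟧} (hf : f = X * t)
    (hp0 : p = X * (C π * A + X ^ n * U)) (h : subst p f = subst f p) :
    (C π * A + X ^ n * U) * subst p t =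
      t * (C π * subst f A + X ^ n * t ^ n * subst f U) := by
  have hp : HasSubst p := HasSubst.of_constantCoeff_zero' (by simp [hp0])
  have hf' : HasSubst f := HasSubst.of_constantCoeff_zero' (by simp [hf])
  have h1 : subst p f = p * subst p t := by
    conv_lhs => rw [hf]
    rw [subst_mul hp, subst_X hp]
  have h2 : subst f p = f * (C π * subst f A + f ^ n * subst f U) := by
    conv_lhs => rw [hp0]
    rw [subst_mul hf', subst_X hf', subst_add hf', subst_mul hf', subst_mul hf', subst_pow hf',
      subst_X hf', subst_C]
    rfl
  rw [h1, h2] at h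
  apply mul_left_cancel₀ (X_ne_zero (R := R))
  rw [← mul_assoc, ← hp0, h]
  conv_rhs => rw [← mul_assoc, ← hf]
  rw [hf]
  ring

theorem constantCoeff_subst_of_zero {f : R⟦X⟧} (hf : constantCoeff f = 0) (g : R⟦X⟧) :
    constantCoeff (subst f g) = constantCoeff g := by
  have hf' : HasSubst f := HasSubst.of_constantCoeff_zero' hf
  obtain ⟨s, hs⟩ := X_dvd_iff.mpr (show constantCoeff (g - C (constantCoeff g)) = 0 by simp)
  rw [sub_eq_iff_eq_add] at hs
  conv_lhs => rw [hs]
  rw [subst_add hf', subst_mul hf', subst_X hf', subst_C, map_add, map_mul, hf, zero_mul, zero_add]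
  exact constantCoeff_C _

/-- If `f` commutes with `p` then `f'(0) ^ (n + 1) ≡ f'(0)` modulo `π`. -/
theorem dvd_pow_sub [IsDomain R] (hp : IsEisensteinSeries p π n) {f : R⟦X⟧}
    (hf : constantCoeff f = 0) (h : subst p f = subst f p) :
    π ∣ coeff 1 f ^ (n + 1) - coeff 1 f := by
  have hp0 := hp.constantCoeff_eq_zero
  obtain ⟨A, U, hp', hA, hU⟩ := hp
  obtain ⟨t, ht⟩ := X_dvd_iff.mpr hf
  -- Modulo `π` the coefficient of `X ^ n` is `U(0) t(0)` on the left and `t(0) ^ (n + 1) U(0)` on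
  -- the right; the unit `U(0)` is then removed.
  have h1 := congrArg (coeff n) (commute_relation ht hp' h)
  have e : t * (C π * subst f A + X ^ n * t ^ n * subst f U) =
    C π * (t * subst f A) + X ^ n * (t ^ (n + 1) * subst f U) := by ring
  have ec : coeff 1 f = constantCoeff t := by
    rw [ht, show 1 = 0 + 1 from rfl, coeff_succ_X_mul, coeff_zero_eq_constantCoeff_apply]
  rw [e, add_mul, mul_assoc, mul_assoc, map_add, map_add, coeff_C_mul, coeff_C_mul,
    coeff_X_pow_mul', coeff_X_pow_mul', if_pos le_rfl, if_pos le_rfl, Nat.sub_self,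
    coeff_zero_eq_constantCoeff_apply, coeff_zero_eq_constantCoeff_apply,
    map_mul constantCoeff, map_mul constantCoeff, map_pow,
    constantCoeff_subst_of_zero hp0, constantCoeff_subst_of_zero hf] at h1
  rw [ec]
  rw [← (isUnit_iff_constantCoeff.mp hU).dvd_mul_left]
  exact ⟨coeff n (A * subst p t) - coeff n (t * subst f A), by linear_combination -h1⟩

/-- If `f` commutes with `p` and `f'(0)` is not a unit then `p` divides `f`. -/
theorem dvd_of_commute [IsDomain R] [IsLocalRing R] (hp : IsEisensteinSeries p π n) (hπ : π ≠ 0)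
    (hn : n ≠ 0) {f : R⟦X⟧} (hf : constantCoeff f = 0) (h : subst p f = subst f p)
    (hc : ¬ IsUnit (coeff 1 f)) : p ∣ f := by
  obtain ⟨A, U, hp', hA, hU⟩ := hp
  obtain ⟨t, ht⟩ := X_dvd_iff.mpr hf
  have h1 := commute_relation ht hp' h
  have ec : coeff 1 f = constantCoeff t := by
    rw [ht, show 1 = 0 + 1 from rfl, coeff_succ_X_mul, coeff_zero_eq_constantCoeff_apply]
  obtain ⟨U', hU'⟩ := hU.exists_right_inv
  -- Eliminating `X ^ n` modulo `W = π A + X ^ n U`, by `X ^ n ≡ -π A U'`, turns the commutation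
  -- relation into `W ∣ π t V`. Its constant term `V(0) = 1 - t(0) ^ n` is a unit because `t(0) =
  -- f'(0)` is not.
  set V := subst f A - A * U' * t ^ n * subst f U with hV
  have hVu : IsUnit V := by
    have e1 : constantCoeff U * constantCoeff U' = 1 := by rw [← map_mul, hU', map_one]
    rw [isUnit_iff_constantCoeff]
    have : constantCoeff V = 1 - constantCoeff t ^ n := by
      simp only [hV, map_sub, map_mul, map_pow, constantCoeff_subst_of_zero hf, hA]
      linear_combination (-constantCoeff t ^ n) * e1
    rw [this, ← ec]
    have := IsLocalRing.isUnit_one_sub_self_of_mem_nonunits (coeff 1 f ^ n)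
      (fun h => hc ((isUnit_pow_iff hn).mp h))
    exact this
  have h2 : C π * A + X ^ n * U ∣ C π * (t * V) := by
    refine ⟨subst p t - t * t ^ n * subst f U * U', ?_⟩
    rw [hV]
    linear_combination h1 * (-1) + X ^ n * t * t ^ n * subst f U * hU'
  have h3 : C π * A + X ^ n * U ∣ t * V := MvPowerSeries.dvd_of_dvd_C_mul hπ () n hU h2
  rw [hVu.dvd_mul_right] at h3
  rw [hp', ht]
  exact mul_dvd_mul_left _ h3

end IsEisensteinSeries

/-- Expansion in powers of `p`. -/
theorem exists_eq_subst_of_step {p : R⟦X⟧} (hp : constantCoeff p = 0) (S : R⟦X⟧ → Prop)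
    (hS : ∀ g, S g → ∃ b g', g = C b + p * g' ∧ S g') {f : R⟦X⟧} (hf : S f) :
    ∃ h : R⟦X⟧, f = subst p h := by
  have hS' : ∀ g : {g // S g}, ∃ (b : R) (g' : {g // S g}), g.1 = C b + p * g'.1 := fun g => by
    obtain ⟨b, g', h, h'⟩ := hS g.1 g.2
    exact ⟨b, ⟨g', h'⟩, h⟩
  choose b s hbs using hS'
  have hp' : HasSubst p := HasSubst.of_constantCoeff_zero' hp
  let H (g : {g // S g}) : R⟦X⟧ := mk fun i => b (s^[i] g)
  have hH (g) : H g = C (b g) + X * H (s g) := by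
    ext i
    rcases i with _ | i
    · simp [H]
    · rw [map_add, coeff_succ_X_mul, coeff_C, if_neg (by omega), zero_add, coeff_mk, coeff_mk,
        Function.iterate_succ_apply]
  have key : ∀ (n : ℕ) (g), X ^ n ∣ g.1 - subst p (H g) := by
    intro n
    induction n with
    | zero => simp
    | succ n ih =>
      intro g
      have : g.1 - subst p (H g) = p * ((s g).1 - subst p (H (s g))) := by
        rw [hH g, subst_add hp', subst_mul hp', subst_X hp', subst_C]
        conv_lhs => rw [hbs g]
        change C (b g) + p * (s g).1 - (C (b g) + p * _) = _
        ring
      rw [this, pow_succ']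
      exact mul_dvd_mul (X_dvd_iff.mpr hp) (ih _)
  refine ⟨H ⟨f, hf⟩, ?_⟩
  rw [← sub_eq_zero]
  ext i
  exact X_pow_dvd_iff.mp (key (i + 1) ⟨f, hf⟩) i (Nat.lt_succ_self i)

end PowerSeries

/-! ### Divisibility and substitution in two variables. -/

namespace MvPowerSeries

variable {R : Type*} [CommRing R]

theorem X_one_dvd_of_subst_eq_zero {G : MvPowerSeries (Fin 2) R}
    (hG : subst ![(PowerSeries.X : PowerSeries R), 0] G = 0) : X 1 ∣ G := by
  classical
  rw [X_dvd_iff]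
  intro m hm
  have hm' : m = Finsupp.single 0 (m 0) := by
    ext s
    fin_cases s
    · simp
    · simpa using hm
  have h1 := congrArg (PowerSeries.coeff (m 0)) hG
  rw [PowerSeries.coeff, coeff_subst (FormalGroup.hasSubst_pair PowerSeries.HasSubst.X'
    PowerSeries.HasSubst.zero'), finsum_eq_single _ m] at h1
  · simp only [Finsupp.prod_fintype, pow_zero, implies_true, Fin.prod_univ_two,
      Matrix.cons_val_zero, Matrix.cons_val_one, hm, mul_one] at h1
    have h2 : coeff (Finsupp.single () (m 0)) ((PowerSeries.X : PowerSeries R) ^ m 0) = 1 :=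
      PowerSeries.coeff_X_pow_self _
    rwa [h2, smul_eq_mul, mul_one, map_zero] at h1
  · intro d hd
    simp only [Finsupp.prod_fintype, pow_zero, implies_true, Fin.prod_univ_two,
      Matrix.cons_val_zero, Matrix.cons_val_one]
    rcases Nat.eq_zero_or_pos (d 1) with h3 | h3
    · have h4 : d 0 ≠ m 0 := by
        intro h4
        apply hd
        ext s
        fin_cases s
        · exact h4
        · exact h3.trans hm.symm
      have h5 : coeff (Finsupp.single () (m 0)) ((PowerSeries.X : PowerSeries R) ^ d 0) = 0 := by
        change PowerSeries.coeff (m 0) _ = 0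
        rw [PowerSeries.coeff_X_pow, if_neg h4.symm]
      rw [h3, pow_zero, mul_one, h5, smul_zero]
    · rw [zero_pow h3.ne', mul_zero, map_zero, smul_zero]

/-- With `R⟦X, Y⟧` read as `R⟦Y⟧⟦X⟧`, a series in `X` has scalar coefficients and a series in `Y` is
a constant. Divisibility by `p(Y)` can then be tested coefficient by coefficient. -/
theorem finSuccEquiv_subst_X_zero (f : PowerSeries R) :
    finSuccEquiv R 1 (PowerSeries.subst (X 0 : MvPowerSeries (Fin 2) R) f) =
      PowerSeries.map C f := by
  classical
  ext k x
  rw [coeff_coeff_finSuccEquiv, PowerSeries.coeff_subst_single, PowerSeries.coeff_map, coeff_C,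
    Finsupp.cons_zero]
  congr 1
  rw [eq_iff_iff]
  constructor
  · intro h
    refine Finsupp.ext fun i => ?_
    simpa using DFunLike.congr_fun h i.succ
  · rintro rfl
    ext i
    fin_cases i <;> simp [Finsupp.cons]

theorem finSuccEquiv_subst_X_one (f : PowerSeries R) :
    finSuccEquiv R 1 (PowerSeries.subst (X 1 : MvPowerSeries (Fin 2) R) f) =
      PowerSeries.C (PowerSeries.subst (X 0 : MvPowerSeries (Fin 1) R) f) := by
  classical
  ext k x
  rw [coeff_coeff_finSuccEquiv, PowerSeries.coeff_subst_single, PowerSeries.coeff_C]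
  have e1 : (x.cons k) 1 = x 0 := rfl
  rw [e1]
  split_ifs with h1 h2 h2
  · rw [PowerSeries.coeff_subst_single, if_pos]
    refine Finsupp.ext fun i => ?_
    fin_cases i
    simp
  · exact absurd (by simpa using DFunLike.congr_fun h1 0) h2
  · refine absurd ?_ h1
    ext i
    fin_cases i
    · simpa using h2
    · simp [e1]
  · simp

end MvPowerSeries

namespace PowerSeries

variable {R : Type*} [CommRing R]

/-- In `R⟦Y⟧⟦X⟧` the coefficient of `X ^ (i + 1)` in `p(X) s` is `π s_i` plus a combination of the
`s_j` with `j < i`. By induction `p(Y) ∣ π s_i`, and `π` can be cancelled there. -/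
theorem IsEisensteinSeries.dvd_of_dvd_mul [IsDomain R] {p : R⟦X⟧} {π : R} {n : ℕ}
    (hp : IsEisensteinSeries p π n) (hπ : π ≠ 0) (hn : n ≠ 0) {s : MvPowerSeries (Fin 2) R}
    (h : subst (MvPowerSeries.X 1 : MvPowerSeries (Fin 2) R) p ∣
      subst (MvPowerSeries.X 0 : MvPowerSeries (Fin 2) R) p * s) :
    subst (MvPowerSeries.X 1 : MvPowerSeries (Fin 2) R) p ∣ s := by
  have hdvd {a : MvPowerSeries (Fin 1) R} {f : PowerSeries (MvPowerSeries (Fin 1) R)} :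
      C a ∣ f ↔ ∀ i, a ∣ coeff i f := by
    constructor
    · rintro ⟨g, rfl⟩ i
      rw [coeff_C_mul]
      exact dvd_mul_right _ _
    · intro h
      choose b hb using h
      exact ⟨mk b, by ext1 i; rw [coeff_C_mul, hb, coeff_mk]⟩
  set e := MvPowerSeries.finSuccEquiv R 1
  have h1 := map_dvd e h
  rw [map_mul, MvPowerSeries.finSuccEquiv_subst_X_zero, MvPowerSeries.finSuccEquiv_subst_X_one,
    hdvd] at h1
  rw [← map_dvd_iff e, MvPowerSeries.finSuccEquiv_subst_X_one, hdvd]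
  obtain ⟨t, ht⟩ := X_dvd_iff.mpr hp.constantCoeff_eq_zero
  have hc : constantCoeff t = π := by
    rw [← hp.coeff_one hn, ht, show 1 = 0 + 1 from rfl, coeff_succ_X_mul,
      coeff_zero_eq_constantCoeff_apply]
  intro i
  induction i using Nat.strong_induction_on with
  | _ i ih =>
  have h2 := h1 (i + 1)
  rw [ht, map_mul (PowerSeries.map _), map_X, mul_assoc, coeff_succ_X_mul, ← ht, coeff_mul,
    Finset.Nat.sum_antidiagonal_eq_sum_range_succ_mk, Finset.sum_range_succ'] at h2
  rw [dvd_add_right] at h2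
  · rw [coeff_map, coeff_zero_eq_constantCoeff_apply, hc] at h2
    exact hp.dvd_of_dvd_C_mul hπ 0 h2
  · refine Finset.dvd_sum fun j hj => Dvd.dvd.mul_left (ih _ ?_) _
    have := Finset.mem_range.mp hj
    omega

/-- Over the fraction field `p` has a compositional inverse `q`, and substituting `q(X)`, `q(Y)`
undoes the substitution. This allows identities to be checked after composing with `P`. -/
theorem subst_pair_injective [IsDomain R] {p : R⟦X⟧} (h0 : constantCoeff p = 0)
    (h1 : coeff 1 p ≠ 0) :
    Function.Injective (MvPowerSeries.subst fun i : Fin 2 =>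
      subst (MvPowerSeries.X i : MvPowerSeries (Fin 2) R) p :
        MvPowerSeries (Fin 2) R → MvPowerSeries (Fin 2) R) := by
  intro s s' h
  let ι := algebraMap R (FractionRing R)
  have hι : Function.Injective ι := IsFractionRing.injective R (FractionRing R)
  set p' := map ι p with hp'
  have h0' : constantCoeff p' = 0 := by
    rw [← coeff_zero_eq_constantCoeff_apply, coeff_map, coeff_zero_eq_constantCoeff_apply, h0,
      map_zero]
  have h1' : IsUnit (coeff 1 p') := by
    rw [coeff_map, isUnit_iff_ne_zero, Ne, map_eq_zero_iff ι hι]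
    exact h1
  set q := substInvOfIsUnit p' h1' with hq
  have hqs : HasSubst q := HasSubst.of_constantCoeff_zero' (constantCoeff_substInvOfIsUnit _ h1')
  have hsub {S : Type _} [CommRing S] {f : S⟦X⟧} (hf : constantCoeff f = 0) :
      MvPowerSeries.HasSubst fun i : Fin 2 =>
        subst (MvPowerSeries.X i : MvPowerSeries (Fin 2) S) f :=
    MvPowerSeries.hasSubst_of_constantCoeff_nilpotent fun i =>
      FormalGroup.hasSubst_subst hf (HasSubst.X i)
  have key (s : MvPowerSeries (Fin 2) R) :
      MvPowerSeries.subst (fun i : Fin 2 =>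
        subst (MvPowerSeries.X i : MvPowerSeries (Fin 2) (FractionRing R)) q)
        (MvPowerSeries.map ι (MvPowerSeries.subst (fun i : Fin 2 =>
          subst (MvPowerSeries.X i : MvPowerSeries (Fin 2) R) p) s)) = MvPowerSeries.map ι s := by
    have hb := hsub (constantCoeff_substInvOfIsUnit p' h1')
    have e (i : Fin 2) : MvPowerSeries.map ι
        (subst (MvPowerSeries.X i : MvPowerSeries (Fin 2) R) p) =
        subst (MvPowerSeries.X i) p' := by
      rw [map_subst (HasSubst.X i), MvPowerSeries.map_X]
    rw [MvPowerSeries.map_subst (hsub h0)]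
    simp only [e]
    rw [MvPowerSeries.subst_comp_subst_apply (hsub h0') hb]
    have e2 (i : Fin 2) : MvPowerSeries.subst (fun i : Fin 2 =>
        subst (MvPowerSeries.X i : MvPowerSeries (Fin 2) (FractionRing R)) q)
        (subst (MvPowerSeries.X i : MvPowerSeries (Fin 2) (FractionRing R)) p') =
        MvPowerSeries.X i := by
      rw [subst, MvPowerSeries.subst_comp_subst_apply (HasSubst.X i).const hb]
      simp only [MvPowerSeries.subst_X hb]
      change subst (subst (MvPowerSeries.X i : MvPowerSeries (Fin 2) (FractionRing R)) q) p' = _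
      rw [← subst_comp_subst_apply hqs (HasSubst.X i), subst_substInvOfIsUnit_right _ h0',
        subst_X (HasSubst.X i)]
    refine (congrArg (fun a => MvPowerSeries.subst a _) (funext e2)).trans ?_
    rw [MvPowerSeries.subst_self, id]
  have h2 : MvPowerSeries.map ι s = MvPowerSeries.map ι s' := by
    rw [← key s, ← key s']
    exact congrArg _ (congrArg _ h)
  ext m
  apply hι
  rw [← MvPowerSeries.coeff_map, h2, MvPowerSeries.coeff_map]

end PowerSeries

/-! ### Division of endomorphisms by `P`. -/

namespace FormalGroup

variable {R : Type*} [CommRing R] (F : FormalGroup R)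

/-- From `F(X, 0) = X` one gets `Y ∣ F(X, Y) - X`; substitute `u` and `v`. -/
theorem dvd_subst_pair_sub {τ : Type*} {u v : MvPowerSeries τ R}
    (hu : PowerSeries.HasSubst u) (hv : PowerSeries.HasSubst v) :
    v ∣ MvPowerSeries.subst ![u, v] F.toPowerSeries - u := by
  have h : MvPowerSeries.X 1 ∣ F.toPowerSeries - MvPowerSeries.X 0 := by
    apply MvPowerSeries.X_one_dvd_of_subst_eq_zero
    have h0 := hasSubst_pair (PowerSeries.HasSubst.X' (R := R)) PowerSeries.HasSubst.zero'
    rw [MvPowerSeries.subst_sub h0, MvPowerSeries.subst_X h0]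
    exact sub_eq_zero.mpr F.Xzero_eq_X
  have huv := hasSubst_pair hu hv
  have := map_dvd (MvPowerSeries.substAlgHom huv) h
  simpa [MvPowerSeries.coe_substAlgHom, MvPowerSeries.subst_sub huv, MvPowerSeries.subst_X huv]
    using this

namespace End

variable {F}

/-- Additivity of `h` may be tested after substituting `P(X)` and `P(Y)`. There, additivity of `P`
turns it into additivity of `f = h(P)`. -/
theorem exists_eq_mul_of_eq_subst [IsDomain R] {f P : F.End} (hP : P.c ≠ 0) {h : PowerSeries R}
    (hf : f.toPowerSeries = PowerSeries.subst P.toPowerSeries h) : ∃ g : F.End, f = g * P := by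
  have h0 : PowerSeries.constantCoeff h = 0 := by
    rw [← PowerSeries.IsEisensteinSeries.constantCoeff_subst_of_zero P.constantCoeff_eq_zero, ← hf]
    exact f.constantCoeff_eq_zero
  have hF := PowerSeries.HasSubst.of_constantCoeff_zero F.zero_constantCoeff
  have hX (i : Fin 2) := PowerSeries.HasSubst.X (S := R) i
  have hPX (i : Fin 2) := hasSubst_subst P.constantCoeff_eq_zero (hX i)
  have hΨ : MvPowerSeries.HasSubst fun i : Fin 2 =>
      PowerSeries.subst (MvPowerSeries.X i : MvPowerSeries (Fin 2) R) P.toPowerSeries :=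
    MvPowerSeries.hasSubst_of_constantCoeff_nilpotent hPX
  have hpair : (fun i : Fin 2 =>
      PowerSeries.subst (MvPowerSeries.X i : MvPowerSeries (Fin 2) R) P.toPowerSeries) =
      ![PowerSeries.subst (MvPowerSeries.X 0) P.toPowerSeries,
        PowerSeries.subst (MvPowerSeries.X 1) P.toPowerSeries] := by
    funext i
    fin_cases i <;> rfl
  refine ⟨⟨h, h0, PowerSeries.subst_pair_injective P.constantCoeff_eq_zero hP ?_⟩, End.ext hf⟩
  have e (i : Fin 2) : MvPowerSeries.subst (fun i : Fin 2 =>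
      PowerSeries.subst (MvPowerSeries.X i : MvPowerSeries (Fin 2) R) P.toPowerSeries)
      (PowerSeries.subst (MvPowerSeries.X i : MvPowerSeries (Fin 2) R) h) =
      PowerSeries.subst (MvPowerSeries.X i : MvPowerSeries (Fin 2) R) f.toPowerSeries := by
    rw [hf, PowerSeries.subst_comp_subst_apply P.hasSubst (hX i), PowerSeries.subst,
      MvPowerSeries.subst_comp_subst_apply (hX i).const hΨ]
    simp only [MvPowerSeries.subst_X hΨ]
    rfl
  rw [subst_add_point F (hasSubst_subst h0 (hX 0)) (hasSubst_subst h0 (hX 1)) hΨ, e, e,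
    ← f.map_add_eq, hf, PowerSeries.subst_comp_subst_apply P.hasSubst hF, P.map_add_eq, ← hpair,
    PowerSeries.subst, MvPowerSeries.subst_comp_subst_apply hF.const hΨ]
  rfl

/-- An endomorphism divisible by `P` as a power series factors through `P`. -/
theorem exists_eq_mul_of_dvd [IsDomain R] {P : F.End} {π : R} {n : ℕ}
    (hP : P.toPowerSeries.IsEisensteinSeries π n) (hπ : π ≠ 0)
    (hn : n ≠ 0) {f : F.End} (hf : P.toPowerSeries ∣ f.toPowerSeries) : ∃ g, f = g * P := by
  have hF := PowerSeries.HasSubst.of_constantCoeff_zero F.zero_constantCoeff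
  have hX (i : Fin 2) := PowerSeries.HasSubst.X (S := R) i
  have hPX (i : Fin 2) := hasSubst_subst P.constantCoeff_eq_zero (hX i)
  have hc : P.c ≠ 0 := by
    rw [c, hP.coeff_one hn]
    exact hπ
  suffices h : ∃ h, f.toPowerSeries = PowerSeries.subst P.toPowerSeries h from
    exists_eq_mul_of_eq_subst hc h.choose_spec
  -- The invariant is `g(F(X, Y)) ≡ g(X)` modulo `P(Y)`: formally, `g` is invariant under
  -- translation by the kernel of `P`.
  refine PowerSeries.exists_eq_subst_of_step P.constantCoeff_eq_zero
    (fun g => PowerSeries.subst (MvPowerSeries.X 1 : MvPowerSeries (Fin 2) R) P.toPowerSeries ∣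
      PowerSeries.subst F.toPowerSeries g - PowerSeries.subst (MvPowerSeries.X 0) g)
    (f := f.toPowerSeries) ?_ ?_
  · intro g hg
    -- Putting `X = 0` in the invariant gives `P ∣ g - g(0)`, which defines the quotient `g'`.
    have h0X := hasSubst_pair (PowerSeries.HasSubst.zero' (R := R)) PowerSeries.HasSubst.X'
    have h1 := map_dvd (MvPowerSeries.substAlgHom h0X) hg
    have e (u : MvPowerSeries (Fin 2) R) (hu : PowerSeries.HasSubst u) (g : PowerSeries R) :
        MvPowerSeries.substAlgHom h0X (PowerSeries.subst u g) =
        PowerSeries.subst (MvPowerSeries.subst ![(0 : PowerSeries R), PowerSeries.X] u) g := by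
      rw [MvPowerSeries.coe_substAlgHom, PowerSeries.subst,
        MvPowerSeries.subst_comp_subst_apply hu.const h0X]
      rfl
    rw [map_sub, e _ (hX 1), e _ (hX 0), e _ hF, MvPowerSeries.subst_X h0X,
      MvPowerSeries.subst_X h0X, show MvPowerSeries.subst _ F.toPowerSeries = _ from F.zeroX_eq_X]
      at h1
    change PowerSeries.subst PowerSeries.X _ ∣ PowerSeries.subst PowerSeries.X g -
      PowerSeries.subst 0 g at h1
    rw [PowerSeries.X_subst, PowerSeries.X_subst, PowerSeries.subst_zero_eq_C_constantCoeff] at h1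
    obtain ⟨g', hg'⟩ := h1
    have hg'' : g = PowerSeries.C (PowerSeries.constantCoeff g) + P.toPowerSeries * g' := by
      rw [← hg', Algebra.algebraMap_self, MvPowerSeries.map_id]
      exact (add_sub_cancel _ g).symm
    refine ⟨_, g', hg'', hP.dvd_of_dvd_mul hπ hn ?_⟩
    rw [hg'', PowerSeries.subst_add hF, PowerSeries.subst_add (hX 0), PowerSeries.subst_mul hF,
      PowerSeries.subst_mul (hX 0), PowerSeries.subst_C, PowerSeries.subst_C, P.map_add_eq] at hg
    -- As `P(F(X, Y)) = F(P(X), P(Y)) ≡ P(X)` modulo `P(Y)`, the invariant of `g` becomes `P(Y) ∣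
    -- P(X) (g'(F) - g'(X))`, and `P(X)` cancels.
    have h2 := dvd_subst_pair_sub F (hPX 0) (hPX 1)
    have h3 := dvd_sub hg (Dvd.dvd.mul_right h2 (PowerSeries.subst F.toPowerSeries g'))
    refine h3.trans (dvd_of_eq ?_)
    ring
  · have h1 : PowerSeries.subst (MvPowerSeries.X 1 : MvPowerSeries (Fin 2) R) P.toPowerSeries ∣
        PowerSeries.subst (MvPowerSeries.X 1 : MvPowerSeries (Fin 2) R) f.toPowerSeries := by
      rw [← PowerSeries.coe_substAlgHom (hX 1)]
      exact map_dvd _ hf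
    refine h1.trans ?_
    rw [f.map_add_eq]
    exact dvd_subst_pair_sub F (hasSubst_subst f.constantCoeff_eq_zero (hX 0))
      (hasSubst_subst f.constantCoeff_eq_zero (hX 1))

/-- The compositional inverse `h` satisfies `h(f) = X`, so it is an endomorphism by the
factorization of `1` through `f`. -/
theorem isUnit_of_isUnit_c [IsDomain R] [CharZero R] [F.IsComm] {f : F.End} (hf : IsUnit f.c) :
    IsUnit f := by
  obtain ⟨g, hg⟩ := exists_eq_mul_of_eq_subst (f := 1) hf.ne_zero
    (PowerSeries.subst_substInvOfIsUnit_left f.toPowerSeries f.constantCoeff_eq_zero hf).symm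
  exact IsUnit.of_mul_eq_one g (by rw [mul_comm, ← hg])

variable [IsDomain R] [CharZero R] [F.IsComm] {P : F.End} {π : R} {n : ℕ}

theorem subst_comm (f g : F.End) : PowerSeries.subst f.toPowerSeries g.toPowerSeries =
    PowerSeries.subst g.toPowerSeries f.toPowerSeries :=
  congrArg toPowerSeries (mul_comm g f)

/-- Every endomorphism with non-unit differential is divisible by `P`. -/
theorem exists_eq_mul_of_not_isUnit [IsLocalRing R]
    (hP : P.toPowerSeries.IsEisensteinSeries π n) (hπ : π ≠ 0)
    (hn : n ≠ 0) {f : F.End} (hf : ¬ IsUnit f.c) : ∃ g, f = g * P :=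
  exists_eq_mul_of_dvd hP hπ hn
    (hP.dvd_of_commute hπ hn f.constantCoeff_eq_zero (subst_comm P f) hf)

/-- Otherwise division by `P` never stops, `c f` is divisible by every power of `π`, and `f = 0` by
injectivity of `c`. -/
theorem exists_eq_unit_mul_pow [IsLocalRing R]
    (hP : P.toPowerSeries.IsEisensteinSeries π n) (hπ : π ≠ 0)
    (hn : n ≠ 0) (hsep : ∀ x : R, (∀ k, π ^ k ∣ x) → x = 0) {f : F.End} (hf : f ≠ 0) :
    ∃ (k : ℕ) (u : F.End), IsUnit u ∧ f = u * P ^ k := by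
  by_contra! hne
  have hdvd (k : ℕ) : ∃ g, f = g * P ^ k := by
    induction k with
    | zero => exact ⟨f, by simp⟩
    | succ k ih =>
      obtain ⟨g, hg⟩ := ih
      obtain ⟨g', hg'⟩ := exists_eq_mul_of_not_isUnit hP hπ hn
        (f := g) fun h => hne k g (isUnit_of_isUnit_c h) hg
      exact ⟨g', by rw [hg, hg', pow_succ']; ring⟩
  refine hf (c_injective ((hsep _ fun k => ?_).trans c_zero.symm))
  obtain ⟨g, hg⟩ := hdvd k
  have hc : cHom F P = π := hP.coeff_one hn
  refine ⟨cHom F g, ?_⟩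
  change cHom F f = _
  rw [hg, map_mul, map_pow, hc, mul_comm]

/-- The endomorphism ring is a valuation ring. -/
theorem valuationRing [IsLocalRing R]
    (hP : P.toPowerSeries.IsEisensteinSeries π n) (hπ : π ≠ 0)
    (hn : n ≠ 0) (hsep : ∀ x : R, (∀ k, π ^ k ∣ x) → x = 0) : ValuationRing F.End := by
  rw [ValuationRing.iff_dvd_total]
  refine ⟨fun a b => ?_⟩
  by_cases ha : a = 0
  · exact Or.inr (ha ▸ dvd_zero b)
  by_cases hb : b = 0
  · exact Or.inl (hb ▸ dvd_zero a)
  obtain ⟨i, u, hu, rfl⟩ := exists_eq_unit_mul_pow hP hπ hn hsep ha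
  obtain ⟨j, v, hv, rfl⟩ := exists_eq_unit_mul_pow hP hπ hn hsep hb
  rw [hu.mul_left_dvd, hv.mul_left_dvd, hu.dvd_mul_left, hv.dvd_mul_left]
  exact (le_total i j).imp (pow_dvd_pow P) (pow_dvd_pow P)

theorem dvd_c_pow_sub_c (hP : P.toPowerSeries.IsEisensteinSeries π n) (f : F.End) :
    π ∣ f.c ^ (n + 1) - f.c :=
  hP.dvd_pow_sub f.constantCoeff_eq_zero (subst_comm P f)

end End

end FormalGroup

/-! ### Fields of definition of commuting series. -/

namespace PowerSeries

variable {R : Type*} [CommRing R]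

theorem coeff_subst_eq_sum {b : R⟦X⟧} (hb : constantCoeff b = 0) (f : R⟦X⟧) (n : ℕ) :
    coeff n (subst b f) = ∑ d ∈ Finset.range (n + 1), coeff d f * coeff n (b ^ d) := by
  rw [coeff_subst' (HasSubst.of_constantCoeff_zero' hb),
    finsum_eq_sum_of_support_subset (s := Finset.range (n + 1))]
  · rfl
  · intro d hd
    by_contra hd'
    apply hd
    have hd'' : n < d := by simpa using hd'
    have := X_pow_dvd_iff.mp (pow_dvd_pow_of_dvd (X_dvd_iff.mpr hb) d) n hd''
    simp only [this, smul_zero]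

/-- As `f(0) = 0`, for `d ≠ 1` the coefficient involves only those of `f` below `n`: for `d ≥ 2`,
changing `f` by a multiple of `X ^ n` changes `f ^ d` by a multiple of `X ^ (n + 1)`. -/
theorem coeff_pow_mem (T : Subring R) {f : R⟦X⟧} (n d : ℕ) (h0 : constantCoeff f = 0)
    (hd : d ≠ 1) (hf : ∀ m < n, coeff m f ∈ T) : coeff n (f ^ d) ∈ T := by
  rcases Nat.eq_zero_or_pos d with rfl | hd0
  · rw [pow_zero, coeff_one]
    split_ifs
    exacts [T.one_mem, T.zero_mem]
  rcases Nat.eq_zero_or_pos n with rfl | hn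
  · rw [coeff_zero_eq_constantCoeff_apply, map_pow, h0, zero_pow hd0.ne']
    exact T.zero_mem
  let φ : PowerSeries T := mk fun m => if h : m < n then ⟨coeff m f, hf m h⟩ else 0
  have hφ (m) (hm : m < n) : coeff m (map T.subtype φ) = coeff m f := by
    rw [coeff_map, coeff_mk, dif_pos hm]
    rfl
  have h1 : X ^ n ∣ f - map T.subtype φ := by
    rw [X_pow_dvd_iff]
    intro m hm
    rw [map_sub, hφ m hm, sub_self]
  have h2 : X ^ (n + 1) ∣ f ^ d - map T.subtype φ ^ d := by
    rw [← geom_sum₂_mul, pow_succ, mul_comm]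
    refine mul_dvd_mul (Finset.dvd_sum fun i hi => ?_) h1
    have hi' := Finset.mem_range.mp hi
    rcases Nat.eq_zero_or_pos i with h4 | h4
    · refine Dvd.dvd.mul_left (dvd_pow (X_dvd_iff.mpr ?_) (by omega)) _
      rw [← coeff_zero_eq_constantCoeff_apply, hφ 0 hn, coeff_zero_eq_constantCoeff_apply, h0]
    · exact Dvd.dvd.mul_right (dvd_pow (X_dvd_iff.mpr h0) h4.ne') _
  have h3 := X_pow_dvd_iff.mp h2 n (Nat.lt_succ_self n)
  rw [map_sub, sub_eq_zero] at h3
  rw [h3, ← map_pow, coeff_map]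
  exact SetLike.coe_mem _

/-- A series `f` that commutes with `p = π X + ⋯` has its coefficients in every subfield that
contains `f'(0)` and the coefficients of `p`. -/
theorem coeff_mem_of_commute {L : Type*} [Field L] (T : Subfield L) {p f : L⟦X⟧}
    (hp0 : constantCoeff p = 0) (hp : ∀ n, coeff n p ∈ T)
    (hπ : ∀ n, 2 ≤ n → coeff 1 p ^ n ≠ coeff 1 p)
    (hf0 : constantCoeff f = 0) (hf1 : coeff 1 f ∈ T) (h : subst p f = subst f p) (n : ℕ) :
    coeff n f ∈ T := by
  induction n using Nat.strong_induction_on with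
  | _ n ih =>
  match n with
  | 0 => rw [coeff_zero_eq_constantCoeff_apply, hf0]; exact T.zero_mem
  | 1 => exact hf1
  | n + 2 =>
  -- The unknown coefficient of `f` occurs with factor `p'(0) ^ (n + 2)` on the left (term `d = n +
  -- 2`) and `p'(0)` on the right (term `d = 1`). All else lies in `T`, so the equation is solved
  -- for it.
  have h1 := congrArg (coeff (n + 2)) h
  have hpn : coeff (n + 2) (p ^ (n + 2)) = coeff 1 p ^ (n + 2) := by
    obtain ⟨t, ht⟩ := X_dvd_iff.mpr hp0
    rw [ht, mul_pow, show 1 = 0 + 1 from rfl, coeff_succ_X_mul, coeff_X_pow_mul', if_pos le_rfl,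
      Nat.sub_self, coeff_zero_eq_constantCoeff_apply, coeff_zero_eq_constantCoeff_apply, map_pow]
  rw [coeff_subst_eq_sum hp0, coeff_subst_eq_sum hf0, Finset.sum_range_succ, hpn,
    ← Finset.add_sum_erase (Finset.range (n + 2 + 1)) _ (a := 1)
      (Finset.mem_range.mpr (by omega)), pow_one] at h1
  have m1 : ∑ d ∈ Finset.range (n + 2), coeff d f * coeff (n + 2) (p ^ d) ∈ T := by
    refine sum_mem fun d hd => T.mul_mem (ih d (Finset.mem_range.mp hd)) ?_
    by_cases hd1 : d = 1
    · rw [hd1, pow_one]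
      exact hp _
    · exact coeff_pow_mem T.toSubring _ _ hp0 hd1 fun m _ => hp m
  have m2 : ∑ d ∈ (Finset.range (n + 2 + 1)).erase 1, coeff d p * coeff (n + 2) (f ^ d) ∈ T :=
    sum_mem fun d hd => T.mul_mem (hp d)
      (coeff_pow_mem T.toSubring _ _ hf0 (Finset.ne_of_mem_erase hd) ih)
  have hne : coeff 1 p ^ (n + 2) - coeff 1 p ≠ 0 := sub_ne_zero.mpr (hπ (n + 2) (by omega))
  have : coeff (n + 2) f = (∑ d ∈ (Finset.range (n + 2 + 1)).erase 1,
      coeff d p * coeff (n + 2) (f ^ d) -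
        ∑ d ∈ Finset.range (n + 2), coeff d f * coeff (n + 2) (p ^ d)) /
      (coeff 1 p ^ (n + 2) - coeff 1 p) := by
    rw [eq_div_iff hne]
    linear_combination h1
  rw [this]
  exact T.div_mem (T.sub_mem m2 m1) (T.sub_mem (T.pow_mem (hp 1) _) (hp 1))

theorem IsEisensteinSeries.map {S : Type*} [CommRing S] (φ : R →+* S) {p : R⟦X⟧} {π : R} {n : ℕ}
    (hp : IsEisensteinSeries p π n) : IsEisensteinSeries (PowerSeries.map φ p) (φ π) n := by
  obtain ⟨A, U, rfl, hA, hU⟩ := hp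
  refine ⟨PowerSeries.map φ A, PowerSeries.map φ U, ?_, ?_, hU.map (PowerSeries.map φ)⟩
  · simp [map_mul (PowerSeries.map φ), map_C]
  · rw [← coeff_zero_eq_constantCoeff_apply, coeff_map, coeff_zero_eq_constantCoeff_apply, hA,
      map_one]

end PowerSeries

/-! ### Descent of endomorphisms to a smaller coefficient ring. -/

namespace FormalGroup.End

/-- Descent of endomorphisms along an injective ring homomorphism. -/
theorem exists_toPowerSeries_eq {R S : Type*} [CommRing R] [CommRing S] (F : FormalGroup R)
    {φ : R →+* S} (hφ : Function.Injective φ) {G : FormalGroup S} (hG : G = F.map φ) (g : G.End)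
    {h : PowerSeries R} (hg : g.toPowerSeries = PowerSeries.map φ h) :
    ∃ f : F.End, f.toPowerSeries = h := by
  subst hG
  have h0 : PowerSeries.constantCoeff h = 0 := by
    apply hφ
    rw [map_zero, ← g.constantCoeff_eq_zero, hg, ← PowerSeries.coeff_zero_eq_constantCoeff_apply,
      ← PowerSeries.coeff_zero_eq_constantCoeff_apply, PowerSeries.coeff_map]
  have hinj : Function.Injective (MvPowerSeries.map φ : MvPowerSeries (Fin 2) R →+* _) := by
    intro a b hab
    ext m
    apply hφ
    rw [← MvPowerSeries.coeff_map, hab, MvPowerSeries.coeff_map]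
  refine ⟨⟨h, h0, hinj ?_⟩, rfl⟩
  have hX (i : Fin 2) := PowerSeries.HasSubst.X (S := R) i
  have e (i : Fin 2) : MvPowerSeries.map φ (PowerSeries.subst (MvPowerSeries.X i) h) =
      PowerSeries.subst (MvPowerSeries.X i) g.toPowerSeries := by
    rw [PowerSeries.map_subst (hX i), MvPowerSeries.map_X, hg]
  rw [PowerSeries.map_subst (PowerSeries.HasSubst.of_constantCoeff_zero F.zero_constantCoeff),
    ← hg, MvPowerSeries.map_subst (hasSubst_pair (hasSubst_subst h0 (hX 0))
      (hasSubst_subst h0 (hX 1)))]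
  refine g.map_add_eq.trans (congrArg (fun a => MvPowerSeries.subst a _) ?_)
  funext i
  fin_cases i
  · exact (e 0).symm
  · exact (e 1).symm

end FormalGroup.End

/-! ### Rings of integers of subfields of `Ω`. -/

namespace PadicSubfield

variable {p : ℕ} [Fact p.Prime] {Ω : Type*} [NormedField Ω] [NormedAlgebra ℚ_[p] Ω]
  [IsUltrametricDist Ω]

theorem mem_integers_iff {k : IntermediateField ℚ_[p] Ω} {x : k} :
    x ∈ integers k ↔ ‖(x : Ω)‖ ≤ 1 := by
  rw [Valuation.mem_valuationSubring_iff, ← NNReal.coe_le_coe]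
  rfl

theorem norm_toAmbient_le_one {k : IntermediateField ℚ_[p] Ω} (x : integers k) :
    ‖toAmbient k x‖ ≤ 1 :=
  mem_integers_iff.mp x.2

theorem toAmbient_injective (k : IntermediateField ℚ_[p] Ω) :
    Function.Injective (toAmbient k) :=
  (algebraMap k Ω).injective.comp Subtype.val_injective

theorem inclusion_injective {E k : IntermediateField ℚ_[p] Ω} (h : E ≤ k) :
    Function.Injective (inclusion h) := fun _ _ hxy =>
  toAmbient_injective E (congrArg (toAmbient k) hxy)

theorem isUnit_iff_norm {k : IntermediateField ℚ_[p] Ω} {x : integers k} :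
    IsUnit x ↔ ‖toAmbient k x‖ = 1 := by
  constructor
  · rintro hx
    obtain ⟨y, hy⟩ := hx.exists_right_inv
    have h1 := congrArg (fun z => ‖toAmbient k z‖) hy
    simp only [map_mul, map_one, norm_mul, norm_one] at h1
    have hx1 := norm_toAmbient_le_one x
    have hy1 := norm_toAmbient_le_one y
    nlinarith [norm_nonneg (toAmbient k x), norm_nonneg (toAmbient k y)]
  · intro hx
    have hx0 : (x : k) ≠ 0 := by
      intro h0
      have : toAmbient k x = 0 := by
        rw [show x = 0 from Subtype.ext h0, map_zero]
      rw [this, norm_zero] at hx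
      exact zero_ne_one hx
    refine IsUnit.of_mul_eq_one ⟨(x : k)⁻¹, mem_integers_iff.mpr ?_⟩
      (Subtype.ext (mul_inv_cancel₀ hx0))
    rw [IntermediateField.coe_inv, norm_inv]
    exact (inv_eq_one.mpr hx).le

theorem not_isUnit_iff_norm {k : IntermediateField ℚ_[p] Ω} {x : integers k} :
    ¬ IsUnit x ↔ ‖toAmbient k x‖ < 1 := by
  rw [isUnit_iff_norm]
  exact ⟨fun h => lt_of_le_of_ne (norm_toAmbient_le_one x) h, fun h => h.ne⟩

/-- A finite-dimensional `k` is complete and proper, so its ring of integers is compact; a compact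
valuation ring with nontrivial valuation (`‖p‖ < 1`) is discrete. -/
theorem isCompleteDiscretelyValued_of_finiteDimensional (k : IntermediateField ℚ_[p] Ω)
    [FiniteDimensional ℚ_[p] k] : IsCompleteDiscretelyValued k where
  isComplete := Submodule.complete_of_finiteDimensional k.toSubalgebra.toSubmodule
  isDiscreteValuationRing := by
    have : ProperSpace k := FiniteDimensional.proper ℚ_[p] k
    let : Valued k NNReal := NormedField.toValued
    have hc : IsCompact (X := k) (Valued.v (R := k) (Γ₀ := NNReal)).integer := by
      have h : ((Valued.v (R := k) (Γ₀ := NNReal)).integer : Set k) = Metric.closedBall 0 1 := by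
        ext x
        rw [mem_closedBall_zero_iff]
        exact mem_integers_iff
      rw [h]
      exact isCompact_closedBall 0 1
    have : CompactSpace (Valued.v (R := k) (Γ₀ := NNReal)).integer :=
      isCompact_iff_compactSpace.mp hc
    have : (Valued.v (R := k) (Γ₀ := NNReal)).IsNontrivial := by
      refine ⟨algebraMap ℚ_[p] k p, ?_, ?_⟩
      · rw [Ne, map_eq_zero, map_eq_zero]
        exact_mod_cast (Fact.out : p.Prime).ne_zero
      · intro h
        have h1 : ‖algebraMap ℚ_[p] k p‖ = 1 := congrArg NNReal.toReal h
        rw [norm_algebraMap'] at h1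
        exact (Padic.norm_p_lt_one (p := p)).ne h1
    exact Valued.integer.isDiscreteValuationRing_of_compactSpace

end PadicSubfield

/-! ### Algebraicity of differentials and finite fields of definition. -/

namespace PadicSubfield

variable {p : ℕ} [Fact p.Prime] {Ω : Type*} [NormedField Ω] [NormedAlgebra ℚ_[p] Ω]
  [IsUltrametricDist Ω]

/-- The powers of `‖π‖` tend to 0. This holds for every `k`, so the valuation ring argument applies
to `Ω` itself. -/
theorem eq_zero_of_forall_pow_dvd {k : IntermediateField ℚ_[p] Ω} {π : integers k}
    (hπ : ¬ IsUnit π) (x : integers k) (hx : ∀ n, π ^ n ∣ x) : x = 0 := by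
  apply toAmbient_injective k
  rw [map_zero, ← norm_le_zero_iff]
  refine ge_of_tendsto' (tendsto_pow_atTop_nhds_zero_of_lt_one (norm_nonneg _)
    (not_isUnit_iff_norm.mp hπ)) fun n => ?_
  obtain ⟨y, rfl⟩ := hx n
  rw [map_mul, map_pow, norm_mul, norm_pow]
  exact mul_le_of_le_one_right (pow_nonneg (norm_nonneg _) _) (norm_toAmbient_le_one y)

variable {E : IntermediateField ℚ_[p] Ω}

open FormalGroup in
/-- The differential of an endomorphism over `O_k` is algebraic over `E`. -/
theorem isIntegral_c (F : FormalGroup (integers E)) [F.IsComm] [FiniteDimensional ℚ_[p] E]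
    {k : IntermediateField ℚ_[p] Ω} (hk : E ≤ k)
    {P : (F.map (inclusion hk)).End} {π : integers k}
    {n : ℕ} (hP : P.toPowerSeries.IsEisensteinSeries π n) (hπ : π ≠ 0) (hπ' : ¬ IsUnit π)
    (hπE : toAmbient k π ∈ E) (hn : n ≠ 0) (f : (F.map (inclusion hk)).End) :
    IsIntegral E (toAmbient k f.c) := by
  let R := (F.map (inclusion hk)).End
  let γ : R →+* Ω := (toAmbient k).comp (End.cHom _)
  let r : R →+* IsLocalRing.ResidueField (integers k) :=
    (IsLocalRing.residue _).comp (End.cHom _)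
  have hr (f : R) : r f ^ (n + 1) = r f := by
    obtain ⟨y, hy⟩ := End.dvd_c_pow_sub_c hP f
    have h1 := congrArg (IsLocalRing.residue _) hy
    rw [map_mul, (IsLocalRing.residue_eq_zero_iff π).mpr hπ', zero_mul, map_sub, map_pow,
      sub_eq_zero] at h1
    exact h1
  have hfin : (Set.range r).Finite := by
    have hne : (Polynomial.X ^ (n + 1) - Polynomial.X : Polynomial
        (IsLocalRing.ResidueField (integers k))) ≠ 0 :=
      FiniteField.X_pow_card_sub_X_ne_zero _ (by omega)
    refine (Polynomial.finite_setOfPred_isRoot hne).subset ?_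
    rintro _ ⟨f, rfl⟩
    simp [Polynomial.IsRoot, hr]
  have : Finite (Set.range r) := hfin
  -- Spanned by the differentials of one representative per residue class; these are the digits of
  -- the expansion below.
  let V : Submodule E Ω := Submodule.span E (Set.range fun y : Set.range r => γ y.2.choose)
  have hVfin : FiniteDimensional E V := FiniteDimensional.span_of_finite E (Set.finite_range _)
  have hVfin' : FiniteDimensional ℚ_[p] (V.restrictScalars ℚ_[p]) :=
    Module.Finite.trans (R := ℚ_[p]) E V
  have hπV (i : ℕ) {v : Ω} (hv : v ∈ V) : toAmbient k π ^ i * v ∈ V :=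
    V.smul_mem ((⟨_, hπE⟩ : E) ^ i) hv
  have happrox (i : ℕ) : ∀ f : R, ∃ v ∈ V, ∃ g : R, γ f = v + toAmbient k π ^ i * γ g := by
    induction i with
    | zero => exact fun f => ⟨0, V.zero_mem, f, by simp⟩
    | succ i ih =>
      intro f
      obtain ⟨v, hv, g, hg⟩ := ih f
      set s : R := (Set.mem_range_self (f := r) g).choose with hs
      have hrs : r s = r g := (Set.mem_range_self (f := r) g).choose_spec
      have hsV : γ s ∈ V := Submodule.subset_span ⟨⟨r g, Set.mem_range_self g⟩, rfl⟩
      -- `g` and its representative `s` have the same residue, so `g - s` is divisible by `P`, which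
      -- costs a factor `π` in the differential.
      have hgs : ¬ IsUnit (g - s).c := by
        change (End.cHom _ (g - s)) ∈ nonunits _
        rw [← IsLocalRing.mem_maximalIdeal, ← IsLocalRing.residue_eq_zero_iff]
        change r (g - s) = 0
        rw [map_sub, hrs, sub_self]
      obtain ⟨g', hg'⟩ := End.exists_eq_mul_of_not_isUnit hP hπ hn hgs
      have hγP : γ P = toAmbient k π := congrArg (toAmbient k) (hP.coeff_one hn)
      have h2 : γ g = γ s + γ g' * toAmbient k π := by
        rw [← hγP, ← map_mul, ← hg', map_sub]
        ring
      exact ⟨v + toAmbient k π ^ i * γ s, V.add_mem hv (hπV i hsV), g', by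
        rw [hg, h2]; ring⟩
  have hmem (f : R) : γ f ∈ V := by
    -- `γ f` is the limit of the `v i ∈ V`, the errors being at most `‖π‖ ^ i`; finite dimension
    -- over `ℚ_[p]` makes `V` closed.
    have hcl : IsClosed ((V.restrictScalars ℚ_[p] : Submodule ℚ_[p] Ω) : Set Ω) :=
      Submodule.closed_of_finiteDimensional _
    choose v hv g hg using fun i => happrox i f
    refine hcl.mem_of_tendsto (f := v) (b := Filter.atTop) ?_ (Filter.Eventually.of_forall hv)
    rw [tendsto_iff_norm_sub_tendsto_zero]
    refine squeeze_zero (fun _ => norm_nonneg _) (fun i => ?_)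
      (tendsto_pow_atTop_nhds_zero_of_lt_one (norm_nonneg _) (not_isUnit_iff_norm.mp hπ'))
    rw [norm_sub_rev, hg i, add_sub_cancel_left, norm_mul, norm_pow]
    exact mul_le_of_le_one_right (pow_nonneg (norm_nonneg _) _) (norm_toAmbient_le_one _)
  -- The powers of `γ f` are values of `γ` at powers of `f`, so the whole algebra `E[γ f]` lies in
  -- the finite-dimensional `V`.
  refine IsIntegral.of_mem_of_fg (Algebra.adjoin E {γ f}) ?_ _
    (Algebra.self_mem_adjoin_singleton _ _)
  refine Submodule.FG.of_le (Submodule.fg_span (Set.finite_range _) : V.FG) ?_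
  rw [Algebra.adjoin_eq_span, Submodule.span_le]
  intro y hy
  obtain ⟨i, rfl⟩ := Submonoid.mem_closure_singleton.mp hy
  rw [← map_pow]
  exact hmem _

variable [CharZero Ω]

theorem endOver_mono (F : FormalGroup (integers E)) [F.IsComm] {k k' : IntermediateField ℚ_[p] Ω}
    (h : E ≤ k) (h' : k ≤ k') : endOver F k h ≤ endOver F k' (h.trans h') := by
  rintro _ ⟨f, rfl⟩
  have e : F.map (inclusion (h.trans h')) = (F.map (inclusion h)).map (inclusion h') := by
    refine FormalGroup.ext ?_
    simp only [FormalGroup.map_toPowerSeries]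
    ext n
    rfl
  exact ⟨FormalGroup.End.map _ (inclusion h') _ e f, FormalGroup.End.c_injective rfl⟩

open FormalGroup in
/-- Endomorphisms over `O_k` are defined over a finite extension of `E`. -/
theorem exists_mem_endOver (F : FormalGroup (integers E)) [F.IsComm] [FiniteDimensional ℚ_[p] E]
    {P : F.End} {π : integers E} {n : ℕ} (hP : P.toPowerSeries.IsEisensteinSeries π n)
    (hπ : π ≠ 0) (hπ' : ¬ IsUnit π) (hn : n ≠ 0) {k : IntermediateField ℚ_[p] Ω} (hk : E ≤ k)
    {f : (F.map (toAmbient E)).End} (hf : f ∈ endOver F k hk) :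
    ∃ (T : IntermediateField ℚ_[p] Ω) (h : E ≤ T),
      IsCompleteDiscretelyValued T ∧ f ∈ endOver F T h := by
  have hπn : ‖toAmbient E π‖ < 1 := not_isUnit_iff_norm.mp hπ'
  have hint : IsIntegral E f.c := by
    obtain ⟨f, rfl⟩ := hf
    have hι := inclusion_injective hk
    exact isIntegral_c F hk (P := End.map F (inclusion hk) _ rfl P) (hP.map (inclusion hk))
      ((map_ne_zero_iff _ hι).mpr hπ) (not_isUnit_iff_norm.mpr hπn) π.1.2 hn f
  let L : IntermediateField E Ω := IntermediateField.adjoin E {f.c}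
  have hL : FiniteDimensional E L := IntermediateField.adjoin.finiteDimensional hint
  let T : IntermediateField ℚ_[p] Ω := L.restrictScalars ℚ_[p]
  have hT : FiniteDimensional ℚ_[p] T := Module.Finite.trans (R := ℚ_[p]) E L
  have hET : E ≤ T := fun x hx => L.algebraMap_mem ⟨x, hx⟩
  refine ⟨T, hET, isCompleteDiscretelyValued_of_finiteDimensional T, ?_⟩
  let P' := End.map F (toAmbient E) _ rfl P
  have hP' : P'.toPowerSeries.IsEisensteinSeries (toAmbient E π) n := hP.map (toAmbient E)
  have hcoeff (m : ℕ) : PowerSeries.coeff m f.toPowerSeries ∈ T.toSubfield := by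
    refine PowerSeries.coeff_mem_of_commute T.toSubfield hP'.constantCoeff_eq_zero
      (fun m => hET (PowerSeries.coeff m P.toPowerSeries).1.2) ?_ f.constantCoeff_eq_zero
      (IntermediateField.mem_adjoin_simple_self E f.c) (End.subst_comm P' f) m
    intro m hm h
    rw [hP'.coeff_one hn] at h
    have h2 : 0 < ‖toAmbient E π‖ :=
      norm_pos_iff.mpr ((map_ne_zero_iff _ (toAmbient_injective E)).mpr hπ)
    have h3 : ‖toAmbient E π‖ ^ m < ‖toAmbient E π‖ :=
      pow_lt_self_of_lt_one₀ h2 hπn (by omega)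
    rw [← norm_pow, h] at h3
    exact lt_irrefl _ h3
  -- Integrality of the coefficients comes from `O_k`, whereas their membership in `T` comes from
  -- commutation with `P`.
  have hnorm (m : ℕ) : ‖PowerSeries.coeff m f.toPowerSeries‖ ≤ 1 := by
    obtain ⟨f, rfl⟩ := hf
    exact norm_toAmbient_le_one (PowerSeries.coeff m f.toPowerSeries)
  let g : PowerSeries (integers T) := PowerSeries.mk fun m =>
    ⟨⟨_, hcoeff m⟩, mem_integers_iff.mpr (hnorm m)⟩
  have hg : f.toPowerSeries = PowerSeries.map (toAmbient T) g := by
    ext m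
    rw [PowerSeries.coeff_map, PowerSeries.coeff_mk]
    rfl
  obtain ⟨f', hf'⟩ := End.exists_toPowerSeries_eq (F.map (inclusion hET))
    (toAmbient_injective T) (by
      refine FormalGroup.ext ?_
      simp only [FormalGroup.map_toPowerSeries]
      ext n
      rfl) f hg
  exact ⟨f', End.ext ((congrArg (PowerSeries.map (toAmbient T)) hf').trans hg.symm)⟩

end PadicSubfield

/-! ### The series `[π]` of the formal module, and integral closedness. -/

namespace PadicSubfield

variable {p : ℕ} [Fact p.Prime] {Ω : Type*} [NormedField Ω] [NormedAlgebra ℚ_[p] Ω]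
  [IsUltrametricDist Ω] {E : IntermediateField ℚ_[p] Ω}

/-- For `E / K` unramified the series `[π]` of a formal module of finite height is an Eisenstein
series over `O_E`. -/
theorem exists_isEisensteinSeries {K : IntermediateField ℚ_[p] Ω} {hKE : K ≤ E}
    (hur : IsUnramified hKE) {π : integers K}
    (hπ : IsLocalRing.maximalIdeal (integers K) = Ideal.span {π})
    (M : FormalModule (inclusion (adjoinUniformizer_le hKE π)))
    (hM : M.HasFiniteHeight (uniformizer π)) :
    ∃ n, n ≠ 0 ∧ (M.act (uniformizer π)).toPowerSeries.IsEisensteinSeries (inclusion hKE π) n := by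
  classical
  have hmax : IsLocalRing.maximalIdeal (integers E) = Ideal.span {inclusion hKE π} := by
    rw [← show _ = _ from hur, hπ, Ideal.map_span, Set.image_singleton]
  -- The least such `n` is used: below it the coefficients from degree 2 on are non-units, hence
  -- multiples of `π`, which generates the maximal ideal of `O_E`.
  have h : ∃ n, n ≠ 0 ∧
      IsUnit (PowerSeries.coeff (n + 1) (M.act (uniformizer π)).toPowerSeries) := by
    obtain ⟨i, hi, hu⟩ := hM
    obtain ⟨n, rfl⟩ : ∃ n, i = n + 1 := ⟨i - 1, by omega⟩
    exact ⟨n, by omega, hu⟩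
  obtain ⟨h0, hu⟩ := Nat.find_spec h
  refine ⟨Nat.find h, h0, PowerSeries.isEisensteinSeries_of_coeff h0
    (M.act (uniformizer π)).constantCoeff_eq_zero (M.c_act (uniformizer π)) (fun i hi hlt => ?_) hu⟩
  rw [← Ideal.mem_span_singleton, ← hmax, IsLocalRing.mem_maximalIdeal, mem_nonunits_iff]
  intro hui
  refine Nat.find_min h (m := i - 1) (by omega) ⟨by omega, ?_⟩
  rwa [Nat.sub_add_cancel (by omega)]

variable [CharZero Ω]

open FormalGroup in
-- A valuation ring is integrally closed, and base change to `Ω` identifies the endomorphism ring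
-- over `O_k` with its image.
theorem isIntegrallyClosed_endOver (F : FormalGroup (integers E)) [F.IsComm]
    {P : F.End} {π : integers E} {n : ℕ} (hP : P.toPowerSeries.IsEisensteinSeries π n)
    (hπ : π ≠ 0) (hπ' : ¬ IsUnit π) (hn : n ≠ 0) {k : IntermediateField ℚ_[p] Ω} (hk : E ≤ k) :
    IsIntegrallyClosed (endOver F k hk) := by
  let P' := End.map F (inclusion hk) _ rfl P
  have hP' : P'.toPowerSeries.IsEisensteinSeries (inclusion hk π) n := hP.map (inclusion hk)
  have hu : ¬ IsUnit (inclusion hk π) := by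
    have h := not_isUnit_iff_norm.mp hπ'
    exact not_isUnit_iff_norm.mpr h
  have : ValuationRing (F.map (inclusion hk)).End :=
    End.valuationRing hP' ((map_ne_zero_iff _ (inclusion_injective hk)).mpr hπ) hn
      (eq_zero_of_forall_pow_dvd hu)
  have : IsIntegrallyClosed (F.map (inclusion hk)).End := inferInstance
  refine IsIntegrallyClosed.of_equiv (RingEquiv.ofBijective (RingHom.rangeRestrict _)
    ⟨?_, RingHom.rangeRestrict_surjective _⟩)
  intro f g hfg
  have h := congrArg (fun z => z.1.c) hfg
  exact End.c_injective (toAmbient_injective k h)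

end PadicSubfield

theorem proposition2p3 {p : ℕ} [Fact p.Prime]
    {Ω : Type*} [NormedField Ω] [NormedAlgebra ℚ_[p] Ω] [IsUltrametricDist Ω] [CharZero Ω]
    [IsAlgClosed Ω]
    (K E : IntermediateField ℚ_[p] Ω) [FiniteDimensional ℚ_[p] K] [FiniteDimensional ℚ_[p] E]
    (hKE : K ≤ E) (hur : IsUnramified hKE)
    (π : integers K) (hπ : IsLocalRing.maximalIdeal (integers K) = Ideal.span {π})
    (M : FormalModule (inclusion (adjoinUniformizer_le hKE π)))
    (hM : M.HasFiniteHeight (uniformizer π)) :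
    (absoluteEnd M.toFormalGroup : Set (M.toFormalGroup.map (toAmbient E)).End) =
        {f | ∃ (k : IntermediateField ℚ_[p] Ω) (h : E ≤ k),
          IsCompleteDiscretelyValued k ∧ f ∈ endOver M.toFormalGroup k h} ∧
      IsIntegrallyClosed (absoluteEnd M.toFormalGroup) := by
  obtain ⟨n, hn, hP⟩ := exists_isEisensteinSeries hur hπ M hM
  have hK := (isCompleteDiscretelyValued_of_finiteDimensional K).isDiscreteValuationRing
  have hπ0 : inclusion hKE π ≠ 0 := by
    rw [map_ne_zero_iff _ (inclusion_injective hKE)]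
    rintro rfl
    exact IsDiscreteValuationRing.not_a_field (integers K) (by simpa using hπ)
  have hπu : ¬ IsUnit (inclusion hKE π) := by
    refine not_isUnit_iff_norm.mpr (not_isUnit_iff_norm (x := π).mp ?_)
    rw [← mem_nonunits_iff, ← IsLocalRing.mem_maximalIdeal, hπ]
    exact Ideal.mem_span_singleton_self π
  -- The field `⊤` is `Ω`, which need not be complete or discretely valued; descent to a finite
  -- extension requires neither, so it applies to all endomorphisms over `O_Ω`.
  have hle : absoluteEnd M.toFormalGroup ≤ endOver M.toFormalGroup ⊤ le_top :=
    iSup_le fun k => iSup_le fun h => iSup_le fun _ => endOver_mono _ h le_top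
  have hunion : (absoluteEnd M.toFormalGroup : Set (M.toFormalGroup.map (toAmbient E)).End) =
      {f | ∃ (k : IntermediateField ℚ_[p] Ω) (h : E ≤ k),
        IsCompleteDiscretelyValued k ∧ f ∈ endOver M.toFormalGroup k h} := by
    ext f
    constructor
    · exact fun hf => exists_mem_endOver _ hP hπ0 hπu hn le_top (hle hf)
    · rintro ⟨k, h, hk, hf⟩
      exact (le_iSup_of_le k (le_iSup_of_le h (le_iSup_of_le hk le_rfl)) :
        endOver M.toFormalGroup k h ≤ absoluteEnd M.toFormalGroup) hf
  have htop : absoluteEnd M.toFormalGroup = endOver M.toFormalGroup ⊤ le_top := by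
    refine le_antisymm hle fun f hf => ?_
    have := exists_mem_endOver _ hP hπ0 hπu hn le_top hf
    rwa [← SetLike.mem_coe, hunion]
  refine ⟨hunion, ?_⟩
  rw [htop]
  exact isIntegrallyClosed_endOver _ hP hπ0 hπu hn le_top
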